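/- Let $\alpha\in(0,2)$ and $M>0$. There are constants $K,\kappa>0$, depending only on $\alpha$ and $M$, with the following property. Let $\nu$ be a L\'evy measure on $\mathbb R$ ($\nu(\{0\})=0$, $\int(x^2\wedge1)\,\nu(dx)<\infty$) with Lebesgue density $p$, let $\Delta\in(0,1)$ and $\varepsilon\in(0,1]$, and suppose that $$\int_{[-\eta,\eta]}x^2p(x)\,dx\ \ge\ M\eta^{2-\alpha}\qquad\text{for all }0<\eta\le\varepsilon$$ and that $\lambda\Delta\le1$, where $\lambda=\nu(\mathbb R\setminus[-\varepsilon,\varepsilon])$. Let $X$ be a pure jump L\'evy process with triplet $(\gamma_\nu,0,\nu)$, i.e. $$\mathbb E[e^{iuX_t}]=\exp\Big(itu\gamma_\nu+t\int_{\mathbb R}\big(e^{iux}-1-iux\mathbf 1_{|x|<1}\big)\nu(dx)\Big),$$ where $\gamma_\nu=\int_{|x|\le1}x\,\nu(dx)$ if $\int_{|x|\le1}|x|\,\nu(dx)<\infty$ and $\gamma_\nu=0$ otherwise. Let $X^S$ be the centred martingale part of the jumps of $X$ of size at most $\varepsilon$, that is, in law, the L\'evy process with $\mathbb E[e^{iuX^S_t}]=\exp\big(t\int_{|x|\le\varepsilon}(e^{iux}-1-iux)\,\nu(dx)\big)$,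 and let $b_\nu=\int_{|x|\le\varepsilon}x\,\nu(dx)$ if $\int_{|x|\le1}|x|\,\nu(dx)<\infty$ and $b_\nu=-\int_{\varepsilon<|x|\le1}x\,\nu(dx)$ otherwise. Then $Z_\Delta=\Delta b_\nu+X^S_\Delta$ has a density $g_\Delta\in L^2(\mathbb R)$. For $m>0$ let $g_{\Delta,m}(x)=\frac1{2\pi}\int_{-m}^m\mathbb E[e^{iuZ_\Delta}]\,e^{-iux}\,du$, and let $$\tilde g_{\Delta,m}(x)=\frac1{2\pi}\int_{-m}^m\Big(\frac1n\sum_{j=1}^ne^{iu(X_{j\Delta}-X_{(j-1)\Delta})}\Big)e^{-iux}\,du$$ be the naive spectral estimator based on $n\ge1$ increments. With $\|\cdot\|$ the norm of $L^2(\mathbb R)$, for all $n\ge1$ and all real $m\ge1$, $$\mathbb E\big[\|\tilde g_{\Delta,m}-g_\Delta\|^2\big]\le K\Big(\|g_{\Delta,m}-g_\Delta\|^2+\frac mn+\lambda^2\Delta^{2-\frac1\alpha}e^{-\kappa\Delta/\varepsilon^\alpha}+\lambda^2\Delta^2\varepsilon^{-1}\Big).$$ Moreover, for all $m\ge\pi/(2\varepsilon)$,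 $$\|g_{\Delta,m}-g_\Delta\|^2\le C\,\Delta^{-1/\alpha}\,\Gamma\big(1/\alpha,\ c\,\Delta m^\alpha\big),\qquad C=\frac1{2\alpha(2M)^{1/\alpha}},\quad c=\frac{2^{\alpha+1}M}{\pi^\alpha},$$ where $\Gamma(a,s)=\int_s^\infty t^{a-1}e^{-t}\,dt$. -/

import Mathlib

open MeasureTheory ProbabilityTheory Filter Topology Set
open scoped NNReal ENNReal

namespace SmallJumps

noncomputable section

/-- `ν` is a Lévy measure on `ℝ`: no mass at `0` and `∫ (x² ∧ 1) dν < ∞`. -/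
structure IsLevyMeasure (ν : Measure ℝ) : Prop where
  zero : ν {0} = 0
  lintegral_lt_top : ∫⁻ x, ENNReal.ofReal (min (x ^ 2) 1) ∂ν < ∞

/-- `p` is a (nonnegative, measurable) density of `ν` with respect to Lebesgue measure. -/
structure IsLevyDensity (ν : Measure ℝ) (p : ℝ → ℝ) : Prop where
  measurable : Measurable p
  nonneg : ∀ x, 0 ≤ p x
  eq_withDensity : ν = volume.withDensity fun x => ENNReal.ofReal (p x)

/-- Orey-type condition: `∫_{[-η,η]} x² p(x) dx ≥ M η^(2-α)` for all `0 < η ≤ ε`. -/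
def OreyCondition (p : ℝ → ℝ) (M α ε : ℝ) : Prop :=
  ∀ η : ℝ, 0 < η → η ≤ ε → M * η ^ (2 - α) ≤ ∫ x in Icc (-η) η, x ^ 2 * p x

/-- The jumps of size at most `1` are summable: `∫_{|x| ≤ 1} |x| dν < ∞`. -/
def FiniteVariation (ν : Measure ℝ) : Prop :=
  IntegrableOn (fun x : ℝ => x) (Icc (-1) 1) ν

open Classical in
/-- The drift `γ_ν` of the Lévy triplet `(γ_ν, 0, ν)`: `∫_{|x| ≤ 1} x dν` in the finite variation
case, `0` otherwise. -/
def drift (ν : Measure ℝ) : ℝ :=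
  if FiniteVariation ν then ∫ x in Icc (-1) 1, x ∂ν else 0

open Classical in
/-- The drift `b_ν` of the Lévy–Itô decomposition at level `ε`: `∫_{|x| ≤ ε} x dν` in the finite
variation case, `-∫_{ε < |x| ≤ 1} x dν` otherwise. -/
def smallDrift (ν : Measure ℝ) (ε : ℝ) : ℝ :=
  if FiniteVariation ν then ∫ x in Icc (-ε) ε, x ∂ν
  else -∫ x in {x : ℝ | ε < |x| ∧ |x| ≤ 1}, x ∂ν

/-- `λ = ν(ℝ ∖ [-ε, ε])`, the intensity of the jumps larger than `ε`. -/
def bigJumpIntensity (ν : Measure ℝ) (ε : ℝ) : ℝ := (ν (Icc (-ε) ε)ᶜ).toReal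

/-- The Lévy–Khintchine exponent of the triplet `(γ_ν, 0, ν)`:
`i u γ_ν + ∫ (e^{iux} - 1 - iux 1_{|x| < 1}) dν`. -/
def levyExponent (ν : Measure ℝ) (u : ℝ) : ℂ :=
  Complex.I * u * drift ν +
    ∫ x : ℝ, (Complex.exp (Complex.I * u * x) - 1 -
      (if |x| < 1 then Complex.I * u * x else 0)) ∂ν

/-- The exponent of the centred small jumps: `∫_{|x| ≤ ε} (e^{iux} - 1 - iux) dν`. -/
def smallJumpExponent (ν : Measure ℝ) (ε : ℝ) (u : ℝ) : ℂ :=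
  ∫ x in Icc (-ε) ε, (Complex.exp (Complex.I * u * x) - 1 - Complex.I * u * x) ∂ν

/-- A real Lévy process: started at `0`, with independent and stationary increments and
càdlàg paths (almost surely). -/
structure IsLevyProcess {Ω : Type*} [MeasurableSpace Ω] (X : ℝ≥0 → Ω → ℝ) (P : Measure Ω) :
    Prop where
  aemeasurable : ∀ t, AEMeasurable (X t) P
  zero : ∀ᵐ ω ∂P, X 0 ω = 0
  indep : HasIndepIncrements X P
  stationary : ∀ s t : ℝ≥0, P.map (fun ω => X (s + t) ω - X s ω) = P.map (X t)
  cadlag : ∀ᵐ ω ∂P, ∀ t : ℝ≥0, ContinuousWithinAt (fun s => X s ω) (Ici t) t ∧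
    ∃ l : ℝ, Tendsto (fun s => X s ω) (𝓝[<] t) (𝓝 l)

/-- `X` is a pure jump Lévy process with Lévy triplet `(γ_ν, 0, ν)`. -/
structure IsPureJumpLevyProcess {Ω : Type*} [MeasurableSpace Ω] (X : ℝ≥0 → Ω → ℝ)
    (P : Measure Ω) (ν : Measure ℝ) : Prop where
  isLevyProcess : IsLevyProcess X P
  charFun_eq : ∀ (t : ℝ≥0) (u : ℝ), charFun (P.map (X t)) u = Complex.exp (t * levyExponent ν u)

/-- `S` is a centred small jump process: the compensated (martingale) Lévy process whose jumps are
governed by `ν` restricted to `[-ε, ε]`. This determines the law of the process `S`. -/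
structure IsSmallJumpProcess {Ω : Type*} [MeasurableSpace Ω] (S : ℝ≥0 → Ω → ℝ)
    (P : Measure Ω) (ν : Measure ℝ) (ε : ℝ) : Prop where
  isLevyProcess : IsLevyProcess S P
  charFun_eq : ∀ (t : ℝ≥0) (u : ℝ),
    charFun (P.map (S t)) u = Complex.exp (t * smallJumpExponent ν ε u)

/-- `Z_Δ = Δ b_ν + S_Δ`. -/
def smallJumpIncrement {Ω : Type*} (S : ℝ≥0 → Ω → ℝ) (ν : Measure ℝ) (ε Δ : ℝ) : Ω → ℝ :=
  fun ω => Δ * smallDrift ν ε + S Δ.toNNReal ω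

/-- The density of a real random variable `Z` with respect to Lebesgue measure. It is meaningful
when `HasPDF Z P volume` holds. -/
def density {Ω : Type*} [MeasurableSpace Ω] (Z : Ω → ℝ) (P : Measure Ω) : ℝ → ℂ :=
  fun x => ((pdf Z P volume x).toReal : ℂ)

/-- The Fourier transform `u ↦ ∫ e^{iux} g(x) dx`. -/
def fourierTr (g : ℝ → ℂ) (u : ℝ) : ℂ := ∫ x : ℝ, Complex.exp (Complex.I * u * x) * g x

/-- The function with Fourier transform `φ 1_{[-m,m]}`:
`x ↦ (2π)⁻¹ ∫_{-m}^{m} φ(u) e^{-iux} du`. -/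
def spectralCutoff (m : ℝ) (φ : ℝ → ℂ) (x : ℝ) : ℂ :=
  (1 / (2 * Real.pi) : ℝ) * ∫ u in (-m)..m, φ u * Complex.exp (-(Complex.I * u * x))

/-- The `j`-th observed increment `X_{(j+1)Δ} - X_{jΔ}`, for `j = 0, 1, …`. -/
def increment {Ω : Type*} (X : ℝ≥0 → Ω → ℝ) (Δ : ℝ) (j : ℕ) (ω : Ω) : ℝ :=
  X ((j + 1) * Δ.toNNReal) ω - X (j * Δ.toNNReal) ω

/-- The empirical characteristic function of the `n` first increments. -/
def empiricalCharFun {Ω : Type*} (X : ℝ≥0 → Ω → ℝ) (Δ : ℝ) (n : ℕ) (ω : Ω) (u : ℝ) : ℂ :=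
  (1 / (n : ℂ)) * ∑ j ∈ Finset.range n, Complex.exp (Complex.I * u * increment X Δ j ω)

/-- The naive spectral estimator `g̃_{Δ,m}`. -/
def naiveEstimator {Ω : Type*} (X : ℝ≥0 → Ω → ℝ) (Δ : ℝ) (n : ℕ) (m : ℝ) (ω : Ω) : ℝ → ℂ :=
  spectralCutoff m (empiricalCharFun X Δ n ω)

/-- The squared `L²` distance `‖f - g‖²`, with values in `[0, ∞]`. -/
def sqDist (f g : ℝ → ℂ) : ℝ≥0∞ := ∫⁻ x, ‖f x - g x‖ₑ ^ 2

/-- The upper incomplete Gamma function `Γ(a, s) = ∫_s^∞ t^(a-1) e^{-t} dt`. -/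
def upperGamma (a s : ℝ) : ℝ := ∫ t in Ioi s, t ^ (a - 1) * Real.exp (-t)

end

end SmallJumps

/-! ### Fourier analysis on the line: Plancherel and inversion for finite measures. -/

namespace SmallJumps

open scoped FourierTransform ContDiff Manifold SchwartzMap

/-! Everything rests on the decay of the characteristic function `φ` of `Z_Δ`. Its modulus is
`exp(-Δ ∫_{|x|≤ε} (1 - cos ux) dν)`. If `|u| ≥ π/(2ε)`, then `η = π/(2|u|)` is at most `ε`. On `|x|
≤ η` one has `1 - cos ux ≥ (4/π²)(ux)²`, and the Orey condition at `η` gives `|φ(u)| ≤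
exp(-BΔ|u|^α)` with `B = 2^α M/π^α` (`OreyCondition.le_integral_one_sub_cos`,
`IsSmallJumpProcess.norm_charFun_le_exp`). Hence `φ` lies in `L¹ ∩ L²`, and Fourier inversion
(`rnDeriv_ae_eq_invFourier`) gives the density and its square integrability.

By Plancherel the bias is `(2π)⁻¹ ∫_{|u|>m} |φ|²`; inserting the decay and substituting `t = 2BΔ
u^α` gives the incomplete Gamma function.

For the risk, Plancherel on `[-m,m]` reduces the error to the empirical characteristic function
minus `φ`. Its distance to the characteristic function of `X_Δ` has mean square at most `1/n` at
each `u`, hence a term of order `m/n`. The characteristic function of `X_Δ` is `φ` times a compound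
Poisson factor, which differs from `1` by at most `2λΔ`, hence a term of order `λ²Δ²‖φ‖²`. Splitting
`‖φ‖²` at `|u| = π/(2ε)` produces `ε⁻¹` from the low frequencies and `Δ^(-1/α) e^{-MΔ/ε^α}` from the
high ones. These estimates are assembled in
`IsPureJumpLevyProcess.lintegral_sqDist_naiveEstimator_le`. -/

/-- The inverse Fourier transform `x ↦ (2π)⁻¹ ∫ h(u) e^{-iux} du`. -/
noncomputable def invFourier (h : ℝ → ℂ) (x : ℝ) : ℂ :=
  (1 / (2 * Real.pi) : ℝ) * ∫ u, h u * Complex.exp (-(Complex.I * u * x))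

theorem continuous_fourier {h : ℝ → ℂ} (hh : Integrable h) : Continuous (𝓕 h) :=
  VectorFourier.fourierIntegral_continuous Real.continuous_fourierChar
    (innerSL ℝ).continuous₂ hh

theorem integral_fourier_smul_eq {f g : ℝ → ℂ} (hf : Integrable f) (hg : Integrable g) :
    ∫ ξ, 𝓕 f ξ • g ξ = ∫ x, f x • 𝓕 g x := by
  simpa using! (VectorFourier.integral_fourierIntegral_smul_eq_flip (L := innerₗ ℝ)
    Real.continuous_fourierChar continuous_inner hf hg)

/-- A real test function, as a complex Schwartz function. -/
noncomputable def testFunction {k : ℝ → ℝ} (hk : ContDiff ℝ ∞ k) (hc : HasCompactSupport k) :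
    𝓢(ℝ, ℂ) :=
  (show HasCompactSupport (Complex.ofRealCLM ∘ k) from hc.comp_left rfl).toSchwartzMap
    (Complex.ofRealCLM.contDiff.comp hk)

theorem testFunction_apply {k : ℝ → ℝ} (hk : ContDiff ℝ ∞ k) (hc : HasCompactSupport k) (x : ℝ) :
    testFunction hk hc x = (k x : ℂ) := rfl

/-- Both sides define the same tempered distribution: the `L²` transform is compatible with the
distributional one, and the integral transform satisfies the same duality by Fubini. Testing on
smooth compactly supported functions suffices. -/
theorem fourier_toLp_ae_eq {h : ℝ → ℂ} (h1 : Integrable h) (h2 : MemLp h 2) :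
    ((𝓕 (h2.toLp h) : Lp ℂ 2 (volume : Measure ℝ)) : ℝ → ℂ) =ᵐ[volume] 𝓕 h := by
  refine ae_eq_of_integral_contDiff_smul_eq
    ((Lp.memLp (𝓕 (h2.toLp h))).locallyIntegrable (by norm_num))
    (continuous_fourier h1).locallyIntegrable fun k hk hc => ?_
  have e1 := congrArg (fun T => T (testFunction hk hc))
    (Lp.fourier_toTemperedDistribution_eq (h2.toLp h))
  simp only [TemperedDistribution.fourier_apply, Lp.toTemperedDistribution_apply] at e1
  have e2 := integral_fourier_smul_eq (testFunction hk hc).integrable h1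
  have e3 : ∫ x, (𝓕 (testFunction hk hc)) x • (h2.toLp h) x
      = ∫ x, 𝓕 (testFunction hk hc : ℝ → ℂ) x • h x := by
    refine integral_congr_ae ?_
    filter_upwards [h2.coeFn_toLp] with x hx
    rw [hx, SchwartzMap.fourier_coe]
  rw [e3, e2] at e1
  simpa [testFunction_apply] using e1.symm

/-- Plancherel's identity on `L¹ ∩ L²`. -/
theorem lintegral_enorm_fourier_sq {h : ℝ → ℂ} (h1 : Integrable h) (h2 : MemLp h 2) :
    ∫⁻ x, ‖𝓕 h x‖ₑ ^ 2 = ∫⁻ x, ‖h x‖ₑ ^ 2 := by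
  have key : ∀ f : ℝ → ℂ, ∫⁻ x, ‖f x‖ₑ ^ 2 = eLpNorm f 2 volume ^ 2 := fun f => by
    rw [eLpNorm_eq_lintegral_rpow_enorm_toReal (by norm_num) (by norm_num),
      ← ENNReal.rpow_natCast, ← ENNReal.rpow_mul]
    simp
  rw [key, key, ← eLpNorm_congr_ae (fourier_toLp_ae_eq h1 h2), ← eLpNorm_congr_ae h2.coeFn_toLp,
    ← Lp.enorm_def, ← Lp.enorm_def, ← ofReal_norm, ← ofReal_norm, Lp.norm_fourier_eq]

theorem invFourier_eq (h : ℝ → ℂ) (x : ℝ) :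
    invFourier h x = (1 / (2 * Real.pi) : ℝ) * 𝓕 h (x / (2 * Real.pi)) := by
  rw [invFourier, Real.fourier_real_eq_integral_exp_smul]
  congr 1
  refine integral_congr_ae (ae_of_all _ fun u => ?_)
  have : (Real.pi : ℂ) ≠ 0 := by exact_mod_cast Real.pi_ne_zero
  simp only [smul_eq_mul]
  rw [mul_comm]
  congr 2
  push_cast
  field_simp

theorem invFourier_eq_fourier_comp (h : ℝ → ℂ) (x : ℝ) :
    invFourier h x = 𝓕 (fun v : ℝ => h (2 * Real.pi * v)) x := by
  rw [invFourier, Real.fourier_real_eq_integral_exp_smul]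
  have := Measure.integral_comp_mul_left
    (fun u : ℝ => h u * Complex.exp (-(Complex.I * u * x))) (2 * Real.pi)
  rw [abs_of_pos (by positivity), Complex.real_smul, inv_eq_one_div] at this
  rw [← this]
  refine integral_congr_ae (ae_of_all _ fun u => ?_)
  simp only [smul_eq_mul]
  rw [mul_comm]
  congr 2
  push_cast
  ring

theorem continuous_invFourier {h : ℝ → ℂ} (h1 : Integrable h) : Continuous (invFourier h) := by
  have : invFourier h = fun x => ((1 / (2 * Real.pi) : ℝ) : ℂ) * 𝓕 h (x / (2 * Real.pi)) :=
    funext fun x => invFourier_eq h x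
  rw [this]
  exact continuous_const.mul ((continuous_fourier h1).comp (continuous_id.div_const _))

theorem lintegral_enorm_invFourier_sq {h : ℝ → ℂ} (h1 : Integrable h) (h2 : MemLp h 2) :
    ∫⁻ x, ‖invFourier h x‖ₑ ^ 2 = ENNReal.ofReal (1 / (2 * Real.pi)) * ∫⁻ u, ‖h u‖ₑ ^ 2 := by
  have hpi : 0 < 2 * Real.pi := by positivity
  simp_rw [invFourier_eq, enorm_mul, mul_pow]
  rw [lintegral_const_mul' _ _ (ENNReal.pow_ne_top enorm_ne_top), ← lintegral_enorm_fourier_sq h1 h2]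
  have hm : Measurable fun x => ‖𝓕 h x‖ₑ ^ 2 := by
    have := (continuous_fourier h1).measurable
    fun_prop
  have hmap : ∫⁻ x, ‖𝓕 h (x / (2 * Real.pi))‖ₑ ^ 2
      = ENNReal.ofReal (2 * Real.pi) * ∫⁻ x, ‖𝓕 h x‖ₑ ^ 2 := by
    have := Real.map_volume_mul_left (a := (2 * Real.pi)⁻¹) (by positivity)
    rw [inv_inv, abs_of_pos hpi] at this
    rw [← smul_eq_mul (ENNReal.ofReal _), ← lintegral_smul_measure, ← this, lintegral_map hm (by fun_prop)]
    simp_rw [div_eq_inv_mul]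
  rw [hmap, ← mul_assoc]
  congr 1
  rw [← ofReal_norm, Complex.norm_real, Real.norm_of_nonneg (by positivity), ← ENNReal.ofReal_pow (by positivity),
    ← ENNReal.ofReal_mul (by positivity)]
  congr 1
  field_simp

/-- Write `k` as the Fourier transform of `𝓕⁻ k`, move the transform onto `μ` by Fubini, where it
becomes `charFun μ`, then move it back on the Lebesgue side, which is where integrability of
`charFun μ` enters. This is inversion in weak form; absolute continuity and the density formula both
follow from it. -/
theorem integral_testFunction_eq {μ : Measure ℝ} [IsFiniteMeasure μ]
    (hφ : Integrable (charFun μ)) (k : 𝓢(ℝ, ℂ)) :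
    ∫ x, k x ∂μ = ∫ x, k x • invFourier (charFun μ) x := by
  have hpi : (2 * Real.pi) ≠ 0 := by positivity
  have hψ : Integrable fun v : ℝ => charFun μ (2 * Real.pi * v) := hφ.comp_mul_left' hpi
  have e1 := VectorFourier.integral_fourierIntegral_smul_eq_flip (L := innerₗ ℝ) (μ := μ)
    (ν := (volume : Measure ℝ)) (f := fun _ => (1 : ℂ)) (g := (𝓕⁻ k : 𝓢(ℝ, ℂ)))
    Real.continuous_fourierChar continuous_inner (integrable_const _) (𝓕⁻ k).integrable
  have e2 : ∀ x, VectorFourier.fourierIntegral Real.fourierChar volume (innerₗ ℝ).flip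
      (𝓕⁻ k : 𝓢(ℝ, ℂ)) x = k x := fun x => by
    rw [flip_innerₗ]
    change 𝓕 ((𝓕⁻ k : 𝓢(ℝ, ℂ)) : ℝ → ℂ) x = k x
    rw [← SchwartzMap.fourier_coe, FourierTransform.fourier_fourierInv_eq]
  have e3 : ∀ ξ : ℝ, VectorFourier.fourierIntegral Real.fourierChar μ (innerₗ ℝ)
      (fun _ => (1 : ℂ)) ξ = charFun μ (2 * Real.pi * (-ξ)) := fun ξ => by
    rw [Real.vector_fourierIntegral_eq_integral_exp_smul, charFun_apply_real]
    refine integral_congr_ae (ae_of_all _ fun u => ?_)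
    simp only [smul_eq_mul, mul_one, innerₗ_apply_apply, RCLike.inner_apply, conj_trivial]
    congr 1
    push_cast
    ring
  simp_rw [e2, e3, one_smul] at e1
  rw [← e1]
  have e4 : ∀ ξ, (𝓕⁻ k : 𝓢(ℝ, ℂ)) ξ = 𝓕 (k : ℝ → ℂ) (-ξ) := fun ξ => by
    rw [SchwartzMap.fourierInv_coe, Real.fourierInv_eq_fourier_neg]
  simp_rw [e4]
  -- The reflection `ξ ↦ -ξ` occurs both in `e3` and in `e4`, so one change of variable removes it.
  rw [integral_neg_eq_self (fun ξ => charFun μ (2 * Real.pi * ξ) • 𝓕 (k : ℝ → ℂ) ξ) volume]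
  simp_rw [invFourier_eq_fourier_comp]
  rw [← integral_fourier_smul_eq k.integrable hψ]
  simp_rw [smul_eq_mul, mul_comm]

theorem norm_invFourier_le (h : ℝ → ℂ) (x : ℝ) :
    ‖invFourier h x‖ ≤ 1 / (2 * Real.pi) * ∫ u, ‖h u‖ := by
  rw [invFourier, norm_mul, Complex.norm_real, Real.norm_of_nonneg (by positivity)]
  gcongr
  refine (norm_integral_le_integral_norm _).trans_eq ?_
  congr 1 with u
  rw [norm_mul, show -(Complex.I * u * x) = ((-(u * x) : ℝ) : ℂ) * Complex.I by push_cast; ring,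
    Complex.norm_exp_ofReal_mul_I, mul_one]

/-- Against test functions `μ` acts through the bounded function `invFourier (charFun μ)`, with
bound `C`. A smooth bump equal to `1` on a null compact `K` and supported in an open set of small
volume forces `μ K` to be small; inner regularity extends this from compacts to measurable sets. -/
theorem absolutelyContinuous_of_integrable_charFun {μ : Measure ℝ} [IsFiniteMeasure μ]
    (hφ : Integrable (charFun μ)) : μ ≪ volume := by
  set C := 1 / (2 * Real.pi) * ∫ u, ‖charFun μ u‖ with hC
  have hC0 : 0 ≤ C := by positivity
  have hcomp : ∀ K : Set ℝ, IsCompact K → volume K = 0 → μ K = 0 := by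
    intro K hK hK0
    refine le_antisymm (ENNReal.le_of_forall_pos_le_add fun δ hδ _ => ?_) (zero_le)
    -- Only `0 ≤ C` is known, so the volume target is `δ / (C + 1)`.
    obtain ⟨U, hKU, hU, hUv⟩ := hK.exists_isOpen_lt_of_lt (μ := volume)
      (ENNReal.ofReal (δ / (C + 1))) (by rw [hK0]; simp; positivity)
    obtain ⟨V, hV, hKV, hVU, hVc⟩ := exists_open_between_and_isCompact_closure hK hU hKU
    obtain ⟨k, hk, hkr, hks, hk1⟩ := exists_contMDiff_support_eq_eq_one_iff 𝓘(ℝ, ℝ) hV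
      hK.isClosed hKV
    have hkc : HasCompactSupport k := by
      rw [HasCompactSupport, tsupport, hks]; exact hVc
    have hk01 : ∀ x, k x ∈ Icc (0 : ℝ) 1 := fun x => hkr (mem_range_self x)
    have e := integral_testFunction_eq hφ (testFunction hk.contDiff hkc)
    simp_rw [testFunction_apply] at e
    rw [integral_complex_ofReal] at e
    have hkint : Integrable k μ := hk.continuous.integrable_of_hasCompactSupport hkc
    have hle : ∫ x, k x ∂μ ≤ C * volume.real V := by
      have : ‖∫ x, (k x : ℂ) • invFourier (charFun μ) x‖ ≤ C * volume.real V := by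
        rw [← setIntegral_eq_integral_of_forall_compl_eq_zero (s := V)]
        · refine norm_setIntegral_le_of_norm_le_const
            ((measure_mono subset_closure).trans_lt hVc.measure_lt_top) fun x _ => ?_
          rw [norm_smul, Complex.norm_real, Real.norm_of_nonneg (hk01 x).1]
          calc k x * ‖invFourier (charFun μ) x‖ ≤ 1 * C :=
                mul_le_mul (hk01 x).2 (norm_invFourier_le _ _) (norm_nonneg _) zero_le_one
            _ = C := one_mul _
        · intro x hx
          rw [← hks, Function.notMem_support] at hx
          simp [hx]
      rw [← e, Complex.norm_real] at this
      exact (le_abs_self _).trans this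
    have hKle : μ.real K ≤ ∫ x, k x ∂μ := by
      rw [← integral_indicator_one hK.measurableSet]
      refine integral_mono ((integrable_const _).indicator hK.measurableSet) hkint fun x => ?_
      by_cases hx : x ∈ K
      · simp [hx, (hk1 x).1 hx]
      · simpa [hx] using (hk01 x).1
    have hVle : volume.real V ≤ δ / (C + 1) := by
      refine ENNReal.toReal_le_of_le_ofReal (by positivity) ?_
      exact (measure_mono (subset_closure.trans hVU)).trans hUv.le
    have : μ.real K ≤ δ := by
      refine hKle.trans (hle.trans ?_)
      calc C * volume.real V ≤ C * (δ / (C + 1)) := by gcongr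
        _ ≤ (C + 1) * (δ / (C + 1)) := by gcongr; linarith
        _ = δ := by field_simp
    rw [zero_add, ← ENNReal.ofReal_coe_nnreal, ← ofReal_measureReal]
    exact ENNReal.ofReal_le_ofReal this
  refine Measure.AbsolutelyContinuous.mk fun s hs hs0 => ?_
  rw [hs.measure_eq_iSup_isCompact]
  simp only [ENNReal.iSup_eq_zero]
  exact fun K hKs hK => hcomp K hK (measure_mono_null hKs hs0)

/-- Fourier inversion: the density of a finite measure with integrable characteristic function. -/
theorem rnDeriv_ae_eq_invFourier {μ : Measure ℝ} [IsFiniteMeasure μ]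
    (hφ : Integrable (charFun μ)) :
    (fun x => ((μ.rnDeriv volume x).toReal : ℂ)) =ᵐ[volume] invFourier (charFun μ) := by
  have hac := absolutelyContinuous_of_integrable_charFun hφ
  refine ae_eq_of_integral_contDiff_smul_eq
    (Measure.integrable_toReal_rnDeriv.ofReal.locallyIntegrable)
    (continuous_invFourier hφ).locallyIntegrable fun k hk hc => ?_
  have e := integral_testFunction_eq hφ (testFunction hk hc)
  simp_rw [testFunction_apply] at e
  rw [← integral_rnDeriv_smul hac] at e
  simp only [Complex.real_smul, smul_eq_mul] at e ⊢
  rw [← e]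
  simp_rw [mul_comm]

end SmallJumps

/-! ### Elementary bounds on `e^{iux}` and on the cosine. -/

namespace SmallJumps

/-- Mean value inequality on the convex half-plane `Re z ≤ 0`, where the derivative of `exp` has
modulus at most `1`. -/
theorem norm_exp_sub_one_le_of_re_nonpos {z : ℂ} (hz : z.re ≤ 0) : ‖Complex.exp z - 1‖ ≤ ‖z‖ := by
  have h := (convex_halfSpace_re_le (0 : ℝ)).norm_image_sub_le_of_norm_hasDerivWithin_le
    (f := Complex.exp) (f' := Complex.exp) (C := 1) (x := 0) (y := z)
    (fun x _ => (Complex.hasDerivAt_exp x).hasDerivWithinAt)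
    (fun x hx => by rw [Complex.norm_exp]; exact Real.exp_le_one_iff.2 hx) (by simp) hz
  simpa using h

theorem norm_exp_I_mul (u x : ℝ) : ‖Complex.exp (Complex.I * u * x)‖ = 1 := by
  rw [show Complex.I * u * x = ((u * x : ℝ) : ℂ) * Complex.I by push_cast; ring,
    Complex.norm_exp_ofReal_mul_I]

theorem norm_exp_I_mul_sub_one_le (u x : ℝ) : ‖Complex.exp (Complex.I * u * x) - 1‖ ≤ 2 := by
  refine (norm_sub_le _ _).trans ?_
  rw [norm_exp_I_mul]; norm_num

/-- The constant `3` comes from `2 + |ux| ≤ 3|ux|²` when `|ux| ≥ 1`. The bound serves for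
integrability of the small jump integrand. -/
theorem norm_exp_I_mul_sub_one_sub_le (u x : ℝ) :
    ‖Complex.exp (Complex.I * u * x) - 1 - Complex.I * u * x‖ ≤ 3 * u ^ 2 * x ^ 2 := by
  have hn : ‖Complex.I * u * x‖ = |u * x| := by simp [abs_mul]
  rw [show 3 * u ^ 2 * x ^ 2 = 3 * |u * x| ^ 2 by rw [sq_abs]; ring]
  rcases le_total |u * x| 1 with h | h
  · have := Complex.norm_exp_sub_one_sub_id_le (x := Complex.I * u * x) (hn.trans_le h)
    rw [hn] at this
    nlinarith [sq_nonneg |u * x|]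
  · have := norm_sub_le (Complex.exp (Complex.I * u * x) - 1) (Complex.I * u * x)
    have h2 := norm_exp_I_mul_sub_one_le u x
    rw [hn] at this
    nlinarith

theorem re_exp_I_mul_sub_one (u x : ℝ) :
    (Complex.exp (Complex.I * u * x) - 1).re = -(1 - Real.cos (u * x)) := by
  rw [show Complex.I * u * x = ((u * x : ℝ) : ℂ) * Complex.I by push_cast; ring,
    Complex.sub_re, Complex.exp_ofReal_mul_I_re, Complex.one_re]
  ring

theorem re_exp_I_mul_sub_one_sub (u x : ℝ) :
    (Complex.exp (Complex.I * u * x) - 1 - Complex.I * u * x).re = -(1 - Real.cos (u * x)) := by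
  rw [Complex.sub_re, re_exp_I_mul_sub_one]
  simp

/-- `1 - cos y ≥ (4/π²) y²` for `|y| ≤ π/2`. -/
theorem four_div_pi_sq_mul_sq_le_one_sub_cos {y : ℝ} (hy : |y| ≤ Real.pi / 2) :
    4 / Real.pi ^ 2 * y ^ 2 ≤ 1 - Real.cos y := by
  rw [← Real.cos_abs, ← sq_abs y]
  generalize hz' : |y| = z at hy
  have hz : 0 ≤ z := hz' ▸ abs_nonneg y
  have hpi := Real.pi_pos
  obtain ⟨t, ht⟩ : ∃ t, t = 2 * z / Real.pi := ⟨_, rfl⟩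
  have ht0 : 0 ≤ t := by rw [ht]; positivity
  have ht1 : t ≤ 1 := by rw [ht, div_le_one hpi]; linarith
  have hzt : z = t * Real.pi / 2 := by rw [ht]; field_simp
  -- Half-angle formula `1 - cos z = 2 sin²(z/2)` with `z/2 = tπ/4`. By concavity the sine lies
  -- above its chord from `0` to `π/4`, so `sin(tπ/4) ≥ t√2/2` and `1 - cos z ≥ t²`.
  have hconc := strictConcaveOn_sin_Icc.concaveOn.2 (x := 0) (y := Real.pi / 4)
    ⟨le_rfl, hpi.le⟩ ⟨by positivity, by linarith⟩ (sub_nonneg.2 ht1) ht0 (by ring)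
  simp only [smul_eq_mul, mul_zero, Real.sin_zero, zero_add, Real.sin_pi_div_four] at hconc
  have hcos : Real.cos z = 1 - 2 * Real.sin (t * (Real.pi / 4)) ^ 2 := by
    have h1 := Real.cos_two_mul (t * (Real.pi / 4))
    have h2 := Real.sin_sq_add_cos_sq (t * (Real.pi / 4))
    rw [show z = 2 * (t * (Real.pi / 4)) by rw [hzt]; ring, h1]
    linarith
  have hsq : (t * (√2 / 2)) ^ 2 ≤ Real.sin (t * (Real.pi / 4)) ^ 2 :=
    pow_le_pow_left₀ (by positivity) hconc 2
  rw [mul_pow, div_pow, Real.sq_sqrt (by norm_num)] at hsq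
  rw [hcos, hzt]
  have : 4 / Real.pi ^ 2 * (t * Real.pi / 2) ^ 2 = t ^ 2 := by field_simp; ring
  rw [this]
  linarith

/-! ### Splitting of the Lévy exponent at jump size `ε`. -/

section LevyMeasure

variable {ν : Measure ℝ} {ε : ℝ}

theorem IsLevyMeasure.integrable_min (hν : IsLevyMeasure ν) :
    Integrable (fun x : ℝ => min (x ^ 2) 1) ν := by
  refine ⟨by fun_prop, ?_⟩
  rw [hasFiniteIntegral_iff_ofReal (ae_of_all _ fun x => by positivity)]
  exact hν.lintegral_lt_top

theorem IsLevyMeasure.measure_compl_lt_top (hν : IsLevyMeasure ν) (hε : 0 < ε) (hε1 : ε ≤ 1) :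
    ν (Icc (-ε) ε)ᶜ < ∞ := by
  refine (measure_mono fun x hx => ?_).trans_lt
    (hν.integrable_min.measure_ge_lt_top (show 0 < ε ^ 2 by positivity))
  have hx' : ε < |x| := by
    by_contra h
    exact hx (abs_le.1 (not_lt.1 h))
  simp only [mem_ofPred_eq, le_min_iff]
  rw [← sq_abs x]
  exact ⟨pow_le_pow_left₀ hε.le hx'.le 2, pow_le_one₀ hε.le hε1⟩

theorem IsLevyMeasure.integrableOn_sq (hν : IsLevyMeasure ν) (hε1 : ε ≤ 1) :
    IntegrableOn (fun x : ℝ => x ^ 2) (Icc (-ε) ε) ν := by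
  refine hν.integrable_min.integrableOn.congr_fun (fun x hx => ?_) measurableSet_Icc
  have : |x| ≤ 1 := (abs_le.2 hx).trans hε1
  exact min_eq_left (by rw [← sq_abs]; exact pow_le_one₀ (abs_nonneg _) this)

theorem IsLevyMeasure.integrableOn_small (hν : IsLevyMeasure ν) (hε1 : ε ≤ 1) (u : ℝ) :
    IntegrableOn (fun x : ℝ => Complex.exp (Complex.I * u * x) - 1 - Complex.I * u * x)
      (Icc (-ε) ε) ν :=
  Integrable.mono' ((hν.integrableOn_sq hε1).const_mul (3 * u ^ 2)) (by fun_prop)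
    (ae_of_all _ fun x => norm_exp_I_mul_sub_one_sub_le u x)

theorem IsLevyMeasure.integrableOn_big (hν : IsLevyMeasure ν) (hε : 0 < ε) (hε1 : ε ≤ 1) (u : ℝ) :
    IntegrableOn (fun x : ℝ => Complex.exp (Complex.I * u * x) - 1) (Icc (-ε) ε)ᶜ ν :=
  Integrable.mono' (integrableOn_const (C := (2 : ℝ)) (hν.measure_compl_lt_top hε hε1).ne)
    (by fun_prop) (ae_of_all _ fun x => norm_exp_I_mul_sub_one_le u x)

/-- The exponent `∫_{|x| > ε} (e^{iux} - 1) dν` of the compound Poisson part. -/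
noncomputable def bigJumpExponent (ν : Measure ℝ) (ε u : ℝ) : ℂ :=
  ∫ x in (Icc (-ε) ε)ᶜ, (Complex.exp (Complex.I * u * x) - 1) ∂ν

theorem IsLevyMeasure.norm_bigJumpExponent_le (hν : IsLevyMeasure ν) (hε : 0 < ε) (hε1 : ε ≤ 1)
    (u : ℝ) : ‖bigJumpExponent ν ε u‖ ≤ 2 * bigJumpIntensity ν ε :=
  norm_setIntegral_le_of_norm_le_const (hν.measure_compl_lt_top hε hε1)
    fun x _ => norm_exp_I_mul_sub_one_le u x

theorem IsLevyMeasure.re_bigJumpExponent (hν : IsLevyMeasure ν) (hε : 0 < ε) (hε1 : ε ≤ 1)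
    (u : ℝ) : (bigJumpExponent ν ε u).re ≤ 0 := by
  have h := integral_re (𝕜 := ℂ) (hν.integrableOn_big hε hε1 u)
  simp only [RCLike.re_eq_complex_re] at h
  rw [bigJumpExponent, ← h]
  refine integral_nonpos fun x => ?_
  simp only [re_exp_I_mul_sub_one, Pi.zero_apply]
  linarith [Real.cos_le_one (u * x)]

theorem IsLevyMeasure.re_smallJumpExponent (hν : IsLevyMeasure ν) (hε1 : ε ≤ 1) (u : ℝ) :
    (smallJumpExponent ν ε u).re = -∫ x in Icc (-ε) ε, (1 - Real.cos (u * x)) ∂ν := by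
  have h := integral_re (𝕜 := ℂ) (hν.integrableOn_small hε1 u)
  simp only [RCLike.re_eq_complex_re] at h
  rw [smallJumpExponent, ← h, ← integral_neg]
  simp only [re_exp_I_mul_sub_one_sub]

theorem IsLevyMeasure.integrableOn_one_sub_cos (hν : IsLevyMeasure ν) (hε1 : ε ≤ 1) (u : ℝ) :
    IntegrableOn (fun x : ℝ => 1 - Real.cos (u * x)) (Icc (-ε) ε) ν := by
  have h := (hν.integrableOn_small hε1 u).re.neg
  simp only [RCLike.re_eq_complex_re, re_exp_I_mul_sub_one_sub] at h
  simpa [IntegrableOn, Pi.neg_def] using h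

/-- Compensating only the jumps below `ε` instead of those below `1` shifts the drift by
`-∫_{ε<|x|≤1} x dν`. Added to `drift`, this gives `smallDrift` in both branches of its definition.
-/
theorem IsLevyMeasure.levyExponent_eq (hν : IsLevyMeasure ν) (hac : ν ≪ volume) (hε : 0 < ε)
    (hε1 : ε ≤ 1) (u : ℝ) :
    levyExponent ν u =
      Complex.I * u * smallDrift ν ε + smallJumpExponent ν ε u + bigJumpExponent ν ε u := by
  set A := Icc (-ε) ε with hA
  set B := Icc (-1 : ℝ) 1 with hB
  have hAm : MeasurableSet A := measurableSet_Icc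
  have hBm : MeasurableSet B := measurableSet_Icc
  have hAB : A ⊆ B := Icc_subset_Icc (by linarith) hε1
  have hset : {x : ℝ | ε < |x| ∧ |x| ≤ 1} = Aᶜ ∩ B := by
    ext x
    simp only [mem_ofPred_eq, mem_inter_iff, mem_compl_iff, hA, hB, mem_Icc, ← abs_le, not_le]
  set F : ℝ → ℂ := fun x => Complex.exp (Complex.I * u * x) - 1 -
    B.indicator (fun x : ℝ => Complex.I * u * x) x with hF
  have hbin : IntegrableOn (B.indicator (fun x : ℝ => Complex.I * u * (x : ℂ))) Aᶜ ν := by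
    refine Integrable.mono' (integrableOn_const (C := |u|) (hν.measure_compl_lt_top hε hε1).ne)
      ((by fun_prop : Measurable fun x : ℝ => Complex.I * u * (x : ℂ)).indicator
        hBm).aestronglyMeasurable (ae_of_all _ fun x => ?_)
    by_cases hx : x ∈ B
    · rw [indicator_of_mem hx]
      have : |x| ≤ 1 := abs_le.2 hx
      simp only [norm_mul, Complex.norm_I, one_mul, Complex.norm_real, Real.norm_eq_abs]
      nlinarith [abs_nonneg u]
    · simp [indicator_of_notMem hx]
  have hFA : EqOn F (fun x : ℝ => Complex.exp (Complex.I * u * x) - 1 - Complex.I * u * x) A :=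
    fun x hx => by simp only [hF, indicator_of_mem (hAB hx)]
  have hFiA : IntegrableOn F A ν := (hν.integrableOn_small hε1 u).congr_fun hFA.symm hAm
  have hFiAc : IntegrableOn F Aᶜ ν := (hν.integrableOn_big hε hε1 u).sub hbin
  have hFi : Integrable F ν := by
    rw [← integrableOn_univ, ← union_compl_self A]; exact hFiA.union hFiAc
  have hJ : ∫ x in Aᶜ, B.indicator (fun x : ℝ => Complex.I * u * (x : ℂ)) x ∂ν =
      Complex.I * u * ((∫ x in Aᶜ ∩ B, x ∂ν : ℝ) : ℂ) := by
    rw [setIntegral_indicator hBm, integral_const_mul, ← integral_complex_ofReal]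
  have hmain : ∫ x : ℝ, (Complex.exp (Complex.I * u * x) - 1 -
      (if |x| < 1 then Complex.I * u * x else 0)) ∂ν =
      smallJumpExponent ν ε u + bigJumpExponent ν ε u
        - Complex.I * u * ((∫ x in Aᶜ ∩ B, x ∂ν : ℝ) : ℂ) := by
    -- Since `ν` has no atoms at `±1`, the strict cutoff `|x| < 1` of the exponent may be replaced
    -- by the closed interval used in the drift.
    have hae : ∀ᵐ x ∂ν, x ∉ ({1, -1} : Set ℝ) :=
      hac.ae_le (measure_eq_zero_iff_ae_notMem.1 ((toFinite _).measure_zero volume))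
    calc _ = ∫ x, F x ∂ν := by
          refine integral_congr_ae ?_
          filter_upwards [hae] with x hx
          simp only [hF, indicator, hB, mem_Icc, ← abs_le]
          have h1 : |x| ≠ 1 := by
            intro h
            rcases eq_or_eq_neg_of_abs_eq h with h | h <;> simp [h] at hx
          have h2 : |x| < 1 ↔ |x| ≤ 1 := ⟨le_of_lt, fun h => lt_of_le_of_ne h h1⟩
          simp only [h2]
      _ = (∫ x in A, F x ∂ν) + ∫ x in Aᶜ, F x ∂ν := (integral_add_compl hAm hFi).symm
      _ = _ := by
          rw [setIntegral_congr_fun hAm hFA]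
          simp only [hF]
          rw [integral_sub (hν.integrableOn_big hε hε1 u) hbin, hJ]
          simp only [smallJumpExponent, bigJumpExponent, hA]
          ring
  rw [levyExponent, hmain, drift, smallDrift]
  split_ifs with hfv
  · have hsplit : ∫ x in B, x ∂ν = (∫ x in A, x ∂ν) + ∫ x in Aᶜ ∩ B, x ∂ν := by
      rw [← setIntegral_union _ (hAm.compl.inter hBm)
        (hfv.mono_set hAB) (hfv.mono_set inter_subset_right)]
      · congr 2
        ext x
        simp only [mem_union, mem_inter_iff, mem_compl_iff]
        exact ⟨fun h => (em (x ∈ A)).imp id fun h' => ⟨h', h⟩, fun h => h.elim (fun h => hAB h) And.right⟩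
      · exact disjoint_left.2 fun x hx hx' => hx'.1 hx
    rw [hsplit]
    push_cast
    ring
  · rw [hset]
    push_cast
    ring

end LevyMeasure

/-! ### The Orey condition as a lower bound on the real part of the exponent. -/

theorem IsLevyDensity.setIntegral_eq {ν : Measure ℝ} {p : ℝ → ℝ} (hp : IsLevyDensity ν p)
    (f : ℝ → ℝ) {s : Set ℝ} (hs : MeasurableSet s) : ∫ x in s, f x ∂ν = ∫ x in s, f x * p x := by
  rw [hp.eq_withDensity, setIntegral_withDensity_eq_setIntegral_toReal_smul
    hp.measurable.ennreal_ofReal (ae_of_all _ fun _ => ENNReal.ofReal_lt_top) _ hs]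
  simp_rw [ENNReal.toReal_ofReal (hp.nonneg _), smul_eq_mul, mul_comm]

/-- The scale `η = π/(2|u|)` is the largest for which `|ux| ≤ π/2` on `[-η, η]`, so the quadratic
bound on the cosine applies there; the integrand is nonnegative on the rest of `[-ε, ε]`. -/
theorem OreyCondition.le_integral_one_sub_cos {ν : Measure ℝ} {p : ℝ → ℝ} {M α ε : ℝ}
    (hO : OreyCondition p M α ε) (hν : IsLevyMeasure ν) (hp : IsLevyDensity ν p) (hε : 0 < ε)
    (hε1 : ε ≤ 1) {u : ℝ} (hu : Real.pi / (2 * ε) ≤ |u|) :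
    2 ^ α * M / Real.pi ^ α * |u| ^ α ≤ ∫ x in Icc (-ε) ε, (1 - Real.cos (u * x)) ∂ν := by
  have hpi := Real.pi_pos
  have hu0 : 0 < |u| := lt_of_lt_of_le (by positivity) hu
  set η := Real.pi / (2 * |u|) with hη
  have hη0 : 0 < η := by positivity
  have hηε : η ≤ ε := by
    rw [div_le_iff₀ (by positivity)] at hu ⊢
    linarith
  have h1 := hO η hη0 hηε
  rw [← hp.setIntegral_eq (fun x => x ^ 2) measurableSet_Icc] at h1
  have hsub : Icc (-η) η ⊆ Icc (-ε) ε := Icc_subset_Icc (by linarith) hηε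
  calc 2 ^ α * M / Real.pi ^ α * |u| ^ α
      = 4 / Real.pi ^ 2 * u ^ 2 * (M * η ^ (2 - α)) := by
        rw [← sq_abs u, hη]
        generalize |u| = w at hu0
        rw [Real.rpow_sub (by positivity), Real.rpow_two, Real.div_rpow hpi.le (by positivity),
          Real.mul_rpow (by norm_num) hu0.le]
        field_simp
        norm_num
    _ ≤ 4 / Real.pi ^ 2 * u ^ 2 * ∫ x in Icc (-η) η, x ^ 2 ∂ν := by gcongr
    _ = ∫ x in Icc (-η) η, 4 / Real.pi ^ 2 * (u * x) ^ 2 ∂ν := by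
        rw [← integral_const_mul]; congr 1 with x; ring
    _ ≤ ∫ x in Icc (-η) η, (1 - Real.cos (u * x)) ∂ν := by
        refine setIntegral_mono_on ?_ ((hν.integrableOn_one_sub_cos hε1 u).mono_set hsub)
          measurableSet_Icc fun x hx => ?_
        · have := ((hν.integrableOn_sq hε1).mono_set hsub).const_mul (4 / Real.pi ^ 2 * u ^ 2)
          refine this.congr (ae_of_all _ fun x => ?_)
          simp only; ring
        · refine four_div_pi_sq_mul_sq_le_one_sub_cos ?_
          rw [abs_mul]
          calc |u| * |x| ≤ |u| * η := by gcongr; exact abs_le.2 hx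
            _ = Real.pi / 2 := by rw [hη]; field_simp
    _ ≤ ∫ x in Icc (-ε) ε, (1 - Real.cos (u * x)) ∂ν :=
        setIntegral_mono_set (hν.integrableOn_one_sub_cos hε1 u)
          (ae_of_all _ fun x => sub_nonneg.2 (Real.cos_le_one _)) hsub.eventuallyLE

/-! ### Integrals of stretched exponentials. -/

theorem integrableOn_exp_neg_mul_rpow {α b : ℝ} (hα : 0 < α) (hb : 0 < b) :
    IntegrableOn (fun x : ℝ => Real.exp (-b * x ^ α)) (Ioi 0) := by
  simpa using integrableOn_rpow_mul_exp_neg_mul_rpow (s := 0) (by norm_num) hα hb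

theorem lintegral_even {f : ℝ → ℝ≥0∞} {S : Set ℝ} (hSm : MeasurableSet S)
    (hS : S ⊆ Ioi 0) :
    ∫⁻ x in {x : ℝ | |x| ∈ S}, f |x| = 2 * ∫⁻ x in S, f x := by
  have hset : {x : ℝ | |x| ∈ S} = S ∪ Neg.neg ⁻¹' S := by
    ext x
    simp only [mem_ofPred_eq, mem_union, mem_preimage]
    rcases le_total 0 x with hx | hx
    · rw [abs_of_nonneg hx]
      exact ⟨Or.inl, fun h => h.elim id fun h => absurd (mem_Ioi.1 (hS h)) (by linarith)⟩
    · rw [abs_of_nonpos hx]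
      exact ⟨Or.inr, fun h => h.elim (fun h => absurd (mem_Ioi.1 (hS h)) (by linarith)) id⟩
  have hdisj : Disjoint S (Neg.neg ⁻¹' S) := disjoint_left.2 fun x hx hx' => by
    have h1 : 0 < x := hS hx
    have h2 : 0 < -x := hS hx'
    linarith
  have h1 : ∫⁻ x in S, f |x| = ∫⁻ x in S, f x :=
    setLIntegral_congr_fun hSm fun x hx => by
      rw [abs_of_pos (hS hx)]
  have h2 := (Measure.measurePreserving_neg (volume : Measure ℝ)).setLIntegral_comp_preimage_emb
    (MeasurableEquiv.neg ℝ).measurableEmbedding (fun x => f |x|) S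
  simp only [abs_neg] at h2
  rw [hset, lintegral_union (measurable_neg hSm) hdisj, h2, h1, two_mul]

/-- `∫_m^∞ e^{-b u^α} du` in terms of the incomplete Gamma function. -/
theorem integral_Ioi_exp_neg_mul_rpow {α b m : ℝ} (hα : 0 < α) (hb : 0 < b) (hm : 0 < m) :
    ∫ u in Ioi m, Real.exp (-b * u ^ α) =
      1 / α * b ^ (-(1 / α)) * upperGamma (1 / α) (b * m ^ α) := by
  -- The substitution `t = b u^α` is done in two stages, `u = x^(1/α)` on all of `(0, ∞)` and then
  -- `t = b x`; the indicator carries the lower limit through the first stage.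
  set g : ℝ → ℝ := (Ioi m).indicator fun u => Real.exp (-b * u ^ α) with hg
  have hmα : 0 < m ^ α := by positivity
  have e1 : ∫ u in Ioi m, Real.exp (-b * u ^ α) = ∫ y in Ioi 0, g y := by
    rw [hg, setIntegral_indicator measurableSet_Ioi, Ioi_inter_Ioi, sup_eq_right.2 hm.le]
  have e2 := integral_comp_mul_left_Ioi (fun t : ℝ => t ^ (1 / α - 1) * Real.exp (-t)) (m ^ α) hb
  have e3 : ∫ x in Ioi 0, (|1 / α| * x ^ (1 / α - 1)) • g (x ^ (1 / α)) =
      ∫ x in Ioi (m ^ α), (1 / α * b ^ (1 - 1 / α)) *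
        ((b * x) ^ (1 / α - 1) * Real.exp (-(b * x))) := by
    have : Ioi (m ^ α) = Ioi 0 ∩ Ioi (m ^ α) := by
      rw [Ioi_inter_Ioi, sup_eq_right.2 hmα.le]
    rw [this, ← setIntegral_indicator measurableSet_Ioi]
    refine setIntegral_congr_fun measurableSet_Ioi fun x (hx : 0 < x) => ?_
    have hiff : x ^ (1 / α) ∈ Ioi m ↔ x ∈ Ioi (m ^ α) := by
      simp only [mem_Ioi, one_div]
      exact Real.lt_rpow_inv_iff_of_pos hm.le hx.le hα
    by_cases h : x ∈ Ioi (m ^ α)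
    · simp only [hg, indicator_of_mem h, indicator_of_mem (hiff.2 h), smul_eq_mul]
      rw [← Real.rpow_mul hx.le, one_div_mul_cancel hα.ne', Real.rpow_one,
        Real.mul_rpow hb.le hx.le, abs_of_pos (by positivity), neg_mul]
      have : b ^ (1 - 1 / α) * b ^ (1 / α - 1) = 1 := by
        rw [← Real.rpow_add hb]; simp
      linear_combination (-(1 / α * x ^ (1 / α - 1) * Real.exp (-(b * x)))) * this
    · simp only [hg, indicator_of_notMem h, indicator_of_notMem (fun h' => h (hiff.1 h')), smul_zero]
  rw [e1, ← integral_comp_rpow_Ioi g (one_div_pos.2 hα).ne', e3, integral_const_mul, e2, upperGamma,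
    smul_eq_mul, Real.rpow_sub hb, Real.rpow_one, Real.rpow_neg hb.le]
  field_simp

theorem lintegral_tail {α b m : ℝ} (hα : 0 < α) (hb : 0 < b) (hm : 0 < m) :
    ∫⁻ u in {u : ℝ | m < |u|}, ENNReal.ofReal (Real.exp (-b * |u| ^ α)) =
      ENNReal.ofReal (2 * (1 / α * b ^ (-(1 / α)) * upperGamma (1 / α) (b * m ^ α))) := by
  have h := lintegral_even (f := fun u => ENNReal.ofReal (Real.exp (-b * u ^ α)))
    (S := Ioi m) measurableSet_Ioi (Ioi_subset_Ioi hm.le)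
  simp only [mem_Ioi] at h
  rw [h, ← ofReal_integral_eq_lintegral_ofReal, integral_Ioi_exp_neg_mul_rpow hα hb hm,
    ENNReal.ofReal_mul (by norm_num : (0 : ℝ) ≤ 2), ENNReal.ofReal_ofNat]
  · exact (integrableOn_exp_neg_mul_rpow hα hb).mono_set (Ioi_subset_Ioi hm.le)
  · exact ae_of_all _ fun x => (Real.exp_pos _).le

theorem lintegral_exp_neg_mul_abs_rpow {α b : ℝ} (hα : 0 < α) (hb : 0 < b) :
    ∫⁻ u : ℝ, ENNReal.ofReal (Real.exp (-b * |u| ^ α)) =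
      ENNReal.ofReal (2 * (b ^ (-(1 / α)) * Real.Gamma (1 / α + 1))) := by
  have h := lintegral_even (f := fun u => ENNReal.ofReal (Real.exp (-b * u ^ α)))
    (S := Ioi 0) measurableSet_Ioi Subset.rfl
  have hset : {x : ℝ | |x| ∈ Ioi (0 : ℝ)} = {0}ᶜ := by ext x; simp
  rw [hset, restrict_compl_singleton] at h
  rw [h, ← ofReal_integral_eq_lintegral_ofReal (integrableOn_exp_neg_mul_rpow hα hb)
    (ae_of_all _ fun x => (Real.exp_pos _).le), integral_exp_neg_mul_rpow hα hb,
    ENNReal.ofReal_mul (by norm_num : (0 : ℝ) ≤ 2), ENNReal.ofReal_ofNat, neg_div]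

theorem integrable_exp_neg_mul_abs_rpow {α b : ℝ} (hα : 0 < α) (hb : 0 < b) :
    Integrable fun u : ℝ => Real.exp (-b * |u| ^ α) := by
  refine ⟨(by fun_prop : Measurable _).aestronglyMeasurable, ?_⟩
  rw [hasFiniteIntegral_iff_ofReal (ae_of_all _ fun x => (Real.exp_pos _).le),
    lintegral_exp_neg_mul_abs_rpow hα hb]
  exact ENNReal.ofReal_lt_top

/-! ### Consequences of stretched exponential decay beyond a threshold `r`. -/

section Decay

variable {φ : ℝ → ℂ} {α b r : ℝ}

theorem integrable_of_norm_le_exp (hφ : Continuous φ) (hφ1 : ∀ u, ‖φ u‖ ≤ 1) (hα : 0 < α)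
    (hb : 0 < b) (hdec : ∀ u, r ≤ |u| → ‖φ u‖ ≤ Real.exp (-b * |u| ^ α)) : Integrable φ := by
  refine Integrable.mono' (g := fun u => (Icc (-r) r).indicator 1 u + Real.exp (-b * |u| ^ α))
    (((integrable_indicator_iff measurableSet_Icc).2
      (integrableOn_const (by simp))).add (integrable_exp_neg_mul_abs_rpow hα hb))
    hφ.aestronglyMeasurable (ae_of_all _ fun u => ?_)
  have hp := Real.exp_pos (-b * |u| ^ α)
  rcases le_total r |u| with h | h
  · exact (hdec u h).trans (le_add_of_nonneg_left (indicator_nonneg (by simp) _))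
  · rw [indicator_of_mem (mem_Icc.2 (abs_le.1 h))]
    simp only [Pi.one_apply]
    linarith [hφ1 u]

theorem memLp_two_of_norm_le_one (hφ : Integrable φ) (hφ1 : ∀ u, ‖φ u‖ ≤ 1) : MemLp φ 2 := by
  rw [memLp_two_iff_integrable_sq_norm hφ.aestronglyMeasurable]
  refine hφ.norm.mono' (by have := hφ.aestronglyMeasurable.norm; exact this.pow 2)
    (ae_of_all _ fun u => ?_)
  rw [Real.norm_of_nonneg (by positivity)]
  nlinarith [hφ1 u, norm_nonneg (φ u)]

theorem lintegral_sq_tail_le (hα : 0 < α) (hb : 0 < b) {m : ℝ} (hm : 0 < m) (hrm : r ≤ m)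
    (hdec : ∀ u, r ≤ |u| → ‖φ u‖ ≤ Real.exp (-b * |u| ^ α)) :
    ∫⁻ u in {u : ℝ | m < |u|}, ‖φ u‖ₑ ^ 2 ≤ ENNReal.ofReal
      (2 * (1 / α * (2 * b) ^ (-(1 / α)) * upperGamma (1 / α) (2 * b * m ^ α))) := by
  rw [← lintegral_tail hα (by positivity) hm]
  refine setLIntegral_mono (by fun_prop) fun u hu => ?_
  rw [← ofReal_norm, ← ENNReal.ofReal_pow (norm_nonneg _)]
  refine ENNReal.ofReal_le_ofReal ((pow_le_pow_left₀ (norm_nonneg _)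
    (hdec u (hrm.trans (le_of_lt hu))) 2).trans_eq ?_)
  rw [← Real.exp_nat_mul]
  congr 1
  push_cast
  ring

/-- Below `r` the integrand is at most `1`. Beyond `r`, one factor of `‖φ u‖²` is bounded by its
value `exp(-b r^α)` at the threshold and the other is integrated over the whole line, which keeps
the exponential gain. -/
theorem lintegral_sq_le (hφ1 : ∀ u, ‖φ u‖ ≤ 1) (hα : 0 < α) (hb : 0 < b) (hr : 0 ≤ r)
    (hdec : ∀ u, r ≤ |u| → ‖φ u‖ ≤ Real.exp (-b * |u| ^ α)) :
    ∫⁻ u, ‖φ u‖ₑ ^ 2 ≤ ENNReal.ofReal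
      (2 * r + Real.exp (-b * r ^ α) * (2 * (b ^ (-(1 / α)) * Real.Gamma (1 / α + 1)))) := by
  have hG : 0 ≤ Real.Gamma (1 / α + 1) := Real.Gamma_nonneg_of_nonneg (by positivity)
  calc ∫⁻ u, ‖φ u‖ₑ ^ 2
      ≤ ∫⁻ u, ((Icc (-r) r).indicator 1 u + ENNReal.ofReal (Real.exp (-b * r ^ α)) *
          ENNReal.ofReal (Real.exp (-b * |u| ^ α))) := by
        refine lintegral_mono fun u => ?_
        rcases le_total r |u| with h | h
        · refine le_add_left ?_
          rw [← ofReal_norm, ← ENNReal.ofReal_pow (norm_nonneg _),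
            ← ENNReal.ofReal_mul (Real.exp_pos _).le]
          refine ENNReal.ofReal_le_ofReal ?_
          have h1 : ‖φ u‖ ≤ Real.exp (-b * r ^ α) := by
            refine (hdec u h).trans (Real.exp_le_exp.2 ?_)
            have : r ^ α ≤ |u| ^ α := Real.rpow_le_rpow hr h hα.le
            nlinarith
          rw [sq]
          exact mul_le_mul h1 (hdec u h) (norm_nonneg _) (Real.exp_pos _).le
        · refine le_add_right ?_
          rw [indicator_of_mem (mem_Icc.2 (abs_le.1 h)), ← ofReal_norm, ← ENNReal.ofReal_pow (norm_nonneg _)]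
          exact ENNReal.ofReal_le_one.2 (pow_le_one₀ (norm_nonneg _) (hφ1 u))
    _ = _ := by
        rw [lintegral_add_left (measurable_one.indicator measurableSet_Icc),
          lintegral_indicator_one measurableSet_Icc,
          lintegral_const_mul' _ _ ENNReal.ofReal_ne_top, lintegral_exp_neg_mul_abs_rpow hα hb,
          Real.volume_Icc, ← ENNReal.ofReal_mul (Real.exp_pos _).le,
          ← ENNReal.ofReal_add (by linarith) (by positivity)]
        congr 2
        ring

end Decay

/-! ### Plancherel for spectral cutoffs. -/

theorem spectralCutoff_eq_invFourier {m : ℝ} (hm : 0 ≤ m) (φ : ℝ → ℂ) :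
    spectralCutoff m φ = invFourier ((Ioc (-m) m).indicator φ) := by
  ext x
  rw [spectralCutoff, invFourier, intervalIntegral.integral_of_le (by linarith),
    ← integral_indicator measurableSet_Ioc]
  congr 2 with u
  rw [indicator_mul_left]

theorem invFourier_sub {h₁ h₂ : ℝ → ℂ} (hh₁ : Integrable h₁) (hh₂ : Integrable h₂) (x : ℝ) :
    invFourier h₁ x - invFourier h₂ x = invFourier (h₁ - h₂) x := by
  have key : ∀ {h : ℝ → ℂ}, Integrable h →
      Integrable fun u : ℝ => h u * Complex.exp (-(Complex.I * u * x)) := fun {h} hh => by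
    refine hh.mul_bdd (c := 1) (by fun_prop) (ae_of_all _ fun u => ?_)
    rw [show -(Complex.I * u * x) = Complex.I * u * ((-x : ℝ) : ℂ) by push_cast; ring,
      norm_exp_I_mul]
  rw [invFourier, invFourier, invFourier, ← mul_sub, ← integral_sub (key hh₁) (key hh₂)]
  simp only [Pi.sub_apply, sub_mul]

theorem sqDist_invFourier {h₁ h₂ : ℝ → ℂ} (hh₁ : Integrable h₁) (hh₂ : Integrable h₂)
    (hL₁ : MemLp h₁ 2) (hL₂ : MemLp h₂ 2) :
    sqDist (invFourier h₁) (invFourier h₂) =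
      ENNReal.ofReal (1 / (2 * Real.pi)) * ∫⁻ u, ‖h₁ u - h₂ u‖ₑ ^ 2 := by
  simp_rw [sqDist, invFourier_sub hh₁ hh₂]
  exact lintegral_enorm_invFourier_sq (hh₁.sub hh₂) (hL₁.sub hL₂)

theorem sqDist_congr_right {f g g' : ℝ → ℂ} (h : g =ᵐ[volume] g') : sqDist f g = sqDist f g' := by
  refine lintegral_congr_ae ?_
  filter_upwards [h] with x hx
  rw [hx]

theorem enorm_sub_sq_le (a b c : ℂ) :
    ‖a - c‖ₑ ^ 2 ≤ 2 * ‖a - b‖ₑ ^ 2 + 2 * ‖b - c‖ₑ ^ 2 := by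
  simp_rw [← ofReal_norm, ← ENNReal.ofReal_pow (norm_nonneg _)]
  rw [← ENNReal.ofReal_ofNat, ← ENNReal.ofReal_mul (by norm_num), ← ENNReal.ofReal_mul (by norm_num),
    ← ENNReal.ofReal_add (by positivity) (by positivity)]
  refine ENNReal.ofReal_le_ofReal ?_
  have h := norm_sub_le_norm_sub_add_norm_sub a b c
  have h0 := norm_nonneg (a - c)
  nlinarith [sq_nonneg (‖a - b‖ - ‖b - c‖)]

/-- Measurability of one summand is enough to split the integral, so nothing is asked of `f`. -/
theorem sqDist_le {f g h : ℝ → ℂ} (hgh : AEMeasurable (fun x => ‖g x - h x‖ₑ ^ 2)) :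
    sqDist f h ≤ 2 * sqDist f g + 2 * sqDist g h := by
  rw [sqDist, sqDist, sqDist, ← lintegral_const_mul' _ _ ENNReal.ofNat_ne_top,
    ← lintegral_const_mul' _ _ ENNReal.ofNat_ne_top,
    ← lintegral_add_right' _ (hgh.const_mul _)]
  exact lintegral_mono fun x => enorm_sub_sq_le _ _ _

theorem integrable_indicator_of_bdd {φ : ℝ → ℂ} (hφ : Measurable φ) {C : ℝ} (hC : ∀ u, ‖φ u‖ ≤ C)
    (m : ℝ) : Integrable ((Ioc (-m) m).indicator φ) := by
  rw [integrable_indicator_iff measurableSet_Ioc]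
  exact Integrable.mono' (integrableOn_const (C := C) (by simp)) hφ.aestronglyMeasurable
    (ae_of_all _ hC)

theorem memLp_indicator_of_bdd {φ : ℝ → ℂ} (hφ : Measurable φ) {C : ℝ} (hC : ∀ u, ‖φ u‖ ≤ C)
    (m : ℝ) : MemLp ((Ioc (-m) m).indicator φ) 2 := by
  rw [memLp_indicator_iff_restrict measurableSet_Ioc]
  exact MemLp.of_bound hφ.aestronglyMeasurable C (ae_of_all _ hC)

theorem sqDist_spectralCutoff_sub {φ₁ φ₂ : ℝ → ℂ} (h₁ : Measurable φ₁) (h₂ : Measurable φ₂)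
    (hb₁ : ∀ u, ‖φ₁ u‖ ≤ 1) (hb₂ : ∀ u, ‖φ₂ u‖ ≤ 1) {m : ℝ} (hm : 0 ≤ m) :
    sqDist (spectralCutoff m φ₁) (spectralCutoff m φ₂) =
      ENNReal.ofReal (1 / (2 * Real.pi)) * ∫⁻ u in Ioc (-m) m, ‖φ₁ u - φ₂ u‖ₑ ^ 2 := by
  rw [spectralCutoff_eq_invFourier hm, spectralCutoff_eq_invFourier hm, sqDist_invFourier
    (integrable_indicator_of_bdd h₁ hb₁ m) (integrable_indicator_of_bdd h₂ hb₂ m)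
    (memLp_indicator_of_bdd h₁ hb₁ m) (memLp_indicator_of_bdd h₂ hb₂ m),
    ← lintegral_indicator measurableSet_Ioc]
  congr 2 with u
  by_cases hu : u ∈ Ioc (-m) m <;> simp [hu]

/-- The bias of the spectral cutoff is the `L²` mass of the tail of the Fourier transform. -/
theorem sqDist_spectralCutoff_self {φ : ℝ → ℂ} (hφ : Measurable φ) (hi : Integrable φ)
    (hb : ∀ u, ‖φ u‖ ≤ 1) {m : ℝ} (hm : 0 ≤ m) :
    sqDist (spectralCutoff m φ) (invFourier φ) =
      ENNReal.ofReal (1 / (2 * Real.pi)) * ∫⁻ u in {u : ℝ | m < |u|}, ‖φ u‖ₑ ^ 2 := by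
  rw [spectralCutoff_eq_invFourier hm, sqDist_invFourier (integrable_indicator_of_bdd hφ hb m) hi
    (memLp_indicator_of_bdd hφ hb m) (memLp_two_of_norm_le_one hi hb)]
  congr 1
  have hae : ({u : ℝ | m < |u|} : Set ℝ) =ᵐ[volume] ((Ioc (-m) m)ᶜ : Set ℝ) := by
    have h : ({u : ℝ | m < |u|} : Set ℝ) = (Icc (-m) m)ᶜ := by
      ext u; simp only [mem_ofPred_eq, mem_compl_iff, mem_Icc, ← abs_le, not_le]
    rw [h]
    exact Ioc_ae_eq_Icc.symm.compl
  rw [setLIntegral_congr hae, ← lintegral_indicator measurableSet_Ioc.compl]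
  congr 1 with u
  by_cases hu : u ∈ Ioc (-m) m <;> simp [hu]

/-! ### Mean square error of the empirical characteristic function. -/

section Empirical

variable {Ω : Type*} [MeasurableSpace Ω] {P : Measure Ω} [IsProbabilityMeasure P] {Y : ℕ → Ω → ℝ}

/-- The variance of a sum of independent terms is the sum of the variances. Each is bounded by a
second moment, so that the cosine and sine contributions can later be added through `cos² + sin² =
1`. -/
theorem integral_sq_sum_sub_le (hY : ∀ j, AEMeasurable (Y j) P) (hind : iIndepFun Y P) {f : ℝ → ℝ}
    (hf : Measurable f) (hf1 : ∀ x, |f x| ≤ 1) {a : ℝ} (ha : ∀ j, ∫ ω, f (Y j ω) ∂P = a) (n : ℕ) :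
    ∫ ω, (∑ j ∈ Finset.range n, f (Y j ω) - n * a) ^ 2 ∂P ≤
      ∑ j ∈ Finset.range n, ∫ ω, f (Y j ω) ^ 2 ∂P := by
  have hm : ∀ j, AEMeasurable (fun ω => f (Y j ω)) P := fun j => hf.comp_aemeasurable (hY j)
  have hL : ∀ j, MemLp (fun ω => f (Y j ω)) 2 P := fun j =>
    MemLp.of_bound (hm j).aestronglyMeasurable 1 (ae_of_all _ fun ω => hf1 _)
  have hI : ∀ j, Integrable (fun ω => f (Y j ω)) P := fun j => (hL j).integrable (by norm_num)
  have hsum := IndepFun.variance_sum (s := Finset.range n) (fun j _ => hL j)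
    fun i _ j _ hij => (hind.indepFun hij).comp hf hf
  rw [variance_eq_integral (Finset.aemeasurable_sum _ fun j _ => hm j)] at hsum
  simp only [Finset.sum_apply] at hsum
  rw [integral_finsetSum _ fun j _ => hI j] at hsum
  simp only [ha, Finset.sum_const, Finset.card_range, nsmul_eq_mul] at hsum
  rw [hsum]
  exact Finset.sum_le_sum fun j _ => variance_le_expectation_sq (hm j).aestronglyMeasurable

theorem integrable_sq_sum_sub (hY : ∀ j, AEMeasurable (Y j) P) {f : ℝ → ℝ}
    (hf : Measurable f) (hf1 : ∀ x, |f x| ≤ 1) (a : ℝ) (n : ℕ) :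
    Integrable (fun ω => (∑ j ∈ Finset.range n, f (Y j ω) - a) ^ 2) P := by
  refine MemLp.integrable_sq (MemLp.sub (memLp_finsetSum _ fun j _ => ?_) (memLp_const a))
  exact MemLp.of_bound (hf.comp_aemeasurable (hY j)).aestronglyMeasurable 1
    (ae_of_all _ fun ω => hf1 _)

/-- The mean squared error of the empirical characteristic function is at most `1/n`. -/
theorem lintegral_enorm_empirical_sub_sq_le (hY : ∀ j, AEMeasurable (Y j) P)
    (hind : iIndepFun Y P) {u : ℝ} {c : ℂ} (hc : ∀ j, charFun (P.map (Y j)) u = c) {n : ℕ}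
    (hn : 1 ≤ n) :
    ∫⁻ ω, ‖(1 / (n : ℂ)) * ∑ j ∈ Finset.range n, Complex.exp (Complex.I * u * Y j ω) - c‖ₑ ^ 2 ∂P
      ≤ ENNReal.ofReal (1 / n) := by
  have hn0 : (n : ℝ) ≠ 0 := by positivity
  set F : Ω → ℝ := fun ω => (∑ j ∈ Finset.range n, Real.cos (u * Y j ω) - n * c.re) ^ 2 +
    (∑ j ∈ Finset.range n, Real.sin (u * Y j ω) - n * c.im) ^ 2 with hF
  have hexp : ∀ j ω, Complex.exp (Complex.I * u * Y j ω) =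
      ⟨Real.cos (u * Y j ω), Real.sin (u * Y j ω)⟩ := fun j ω => by
    rw [show Complex.I * u * Y j ω = ((u * Y j ω : ℝ) : ℂ) * Complex.I by push_cast; ring]
    exact Complex.ext (Complex.exp_ofReal_mul_I_re _) (Complex.exp_ofReal_mul_I_im _)
  have hEi : ∀ j, Integrable (fun ω => Complex.exp (Complex.I * u * Y j ω)) P := fun j => by
    refine Integrable.mono' (integrable_const (1 : ℝ)) ?_
      (ae_of_all _ fun ω => (norm_exp_I_mul u _).le)
    have := hY j
    exact (by fun_prop : AEMeasurable _ P).aestronglyMeasurable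
  have hE : ∀ j, ∫ ω, Complex.exp (Complex.I * u * Y j ω) ∂P = c := fun j => by
    rw [← hc j, charFun_apply_real, integral_map (hY j) (by fun_prop)]
    congr 1 with ω
    congr 1
    ring
  have hcre : ∀ j, ∫ ω, Real.cos (u * Y j ω) ∂P = c.re := fun j => by
    have h := integral_re (𝕜 := ℂ) (hEi j)
    rw [hE j] at h
    simpa [hexp] using h
  have hcim : ∀ j, ∫ ω, Real.sin (u * Y j ω) ∂P = c.im := fun j => by
    have h := integral_im (𝕜 := ℂ) (hEi j)
    rw [hE j] at h
    simpa [hexp] using h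
  have hnorm : ∀ ω, ‖(1 / (n : ℂ)) * ∑ j ∈ Finset.range n,
      Complex.exp (Complex.I * u * Y j ω) - c‖ₑ ^ 2 = ENNReal.ofReal (1 / n ^ 2 * F ω) := fun ω => by
    rw [← ofReal_norm, ← ENNReal.ofReal_pow (norm_nonneg _)]
    congr 1
    have hfac : (1 / (n : ℂ)) * ∑ j ∈ Finset.range n, Complex.exp (Complex.I * u * Y j ω) - c =
        ((1 / n : ℝ) : ℂ) * (∑ j ∈ Finset.range n, Complex.exp (Complex.I * u * Y j ω)
          - (n : ℝ) * c) := by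
      have : (n : ℂ) ≠ 0 := by exact_mod_cast hn0
      push_cast
      field_simp
    rw [hfac, norm_mul, mul_pow, Complex.norm_real, Real.norm_of_nonneg (by positivity),
      ← Complex.normSq_eq_norm_sq, Complex.normSq_apply]
    simp only [hexp, Complex.sub_re, Complex.re_sum, Complex.re_ofReal_mul, Complex.sub_im,
      Complex.im_sum, Complex.im_ofReal_mul, hF]
    ring
  have hcosm : Measurable fun x : ℝ => Real.cos (u * x) := by fun_prop
  have hsinm : Measurable fun x : ℝ => Real.sin (u * x) := by fun_prop
  have hi1 := integrable_sq_sum_sub hY hcosm (fun x => Real.abs_cos_le_one _) (n * c.re) n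
  have hi2 := integrable_sq_sum_sub hY hsinm (fun x => Real.abs_sin_le_one _) (n * c.im) n
  have hFi : Integrable F P := hi1.add hi2
  have hFint : ∫ ω, F ω ∂P ≤ n := by
    rw [hF, integral_add hi1 hi2]
    refine (add_le_add
      (integral_sq_sum_sub_le hY hind hcosm (fun x => Real.abs_cos_le_one _) hcre n)
      (integral_sq_sum_sub_le hY hind hsinm (fun x => Real.abs_sin_le_one _) hcim n)).trans_eq ?_
    -- Paired index by index, the second moments of cosine and sine add up to exactly `1`, hence the
    -- total `n`.
    rw [← Finset.sum_add_distrib]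
    have h1 : ∀ j ∈ Finset.range n, (∫ ω, Real.cos (u * Y j ω) ^ 2 ∂P) +
        ∫ ω, Real.sin (u * Y j ω) ^ 2 ∂P = 1 := fun j _ => by
      have hb : ∀ {f : ℝ → ℝ}, Measurable f → (∀ x, |f x| ≤ 1) →
          Integrable (fun ω => f (Y j ω) ^ 2) P := fun {f} hf hf1 =>
        (MemLp.of_bound (hf.comp_aemeasurable (hY j)).aestronglyMeasurable 1
          (ae_of_all _ fun ω => hf1 _)).integrable_sq
      rw [← integral_add (hb hcosm fun x => Real.abs_cos_le_one _)
        (hb hsinm fun x => Real.abs_sin_le_one _)]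
      simp
    rw [Finset.sum_congr rfl h1]
    simp
  simp_rw [hnorm]
  rw [← ofReal_integral_eq_lintegral_ofReal (hFi.const_mul _)
    (ae_of_all _ fun ω => by simp only [hF]; positivity)]
  refine ENNReal.ofReal_le_ofReal ?_
  rw [integral_const_mul]
  calc 1 / (n : ℝ) ^ 2 * ∫ ω, F ω ∂P ≤ 1 / (n : ℝ) ^ 2 * n := by gcongr
    _ = 1 / (n : ℝ) := by field_simp

end Empirical

/-! ### The observed increments are independent with the law of `X_Δ`. -/

section Increments

variable {Ω : Type*} [MeasurableSpace Ω] {P : Measure Ω} {X : ℝ≥0 → Ω → ℝ}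

theorem IsLevyProcess.aemeasurable_increment (hX : IsLevyProcess X P) (Δ : ℝ) (j : ℕ) :
    AEMeasurable (increment X Δ j) P :=
  (hX.aemeasurable _).sub (hX.aemeasurable _)

theorem IsLevyProcess.iIndepFun_increment (hX : IsLevyProcess X P) (Δ : ℝ) :
    iIndepFun (increment X Δ) P := by
  have h := hX.indep.nat (t := fun j : ℕ => (j : ℝ≥0) * Δ.toNNReal)
    fun i j hij => by dsimp only; gcongr
  simp only [Nat.cast_add, Nat.cast_one] at h
  exact h

theorem IsLevyProcess.map_increment (hX : IsLevyProcess X P) (Δ : ℝ) (j : ℕ) :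
    P.map (increment X Δ j) = P.map (X Δ.toNNReal) := by
  rw [← hX.stationary (j * Δ.toNNReal) Δ.toNNReal]
  congr 1
  ext ω
  rw [increment, add_mul, one_mul]

end Increments

/-! ### Density of a random variable with integrable characteristic function. -/

theorem memLp_two_invFourier {h : ℝ → ℂ} (h1 : Integrable h) (h2 : MemLp h 2) :
    MemLp (invFourier h) 2 := by
  refine ⟨(continuous_invFourier h1).aestronglyMeasurable, ?_⟩
  have key := lintegral_enorm_invFourier_sq h1 h2
  have hfin := lintegral_rpow_enorm_lt_top_of_eLpNorm_lt_top (p := 2) (by norm_num) (by norm_num)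
    h2.eLpNorm_lt_top
  rw [eLpNorm_lt_top_iff_lintegral_rpow_enorm_lt_top (by norm_num) (by norm_num)]
  simp only [ENNReal.toReal_ofNat, ENNReal.rpow_ofNat] at hfin ⊢
  rw [key]
  exact ENNReal.mul_lt_top ENNReal.ofReal_lt_top hfin

section Density

variable {Ω : Type*} [MeasurableSpace Ω] {P : Measure Ω} [IsProbabilityMeasure P] {Z : Ω → ℝ}

theorem hasPDF_of_integrable_charFun (hZ : AEMeasurable Z P)
    (hi : Integrable (charFun (P.map Z))) : HasPDF Z P volume := by
  have := Measure.isProbabilityMeasure_map (μ := P) hZ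
  exact Real.hasPDF_iff.2 ⟨hZ, absolutelyContinuous_of_integrable_charFun hi⟩

theorem density_ae_eq (hZ : AEMeasurable Z P) (hi : Integrable (charFun (P.map Z))) :
    density Z P =ᵐ[volume] invFourier (charFun (P.map Z)) := by
  have := Measure.isProbabilityMeasure_map (μ := P) hZ
  exact rnDeriv_ae_eq_invFourier hi

theorem fourierTr_density (hZ : AEMeasurable Z P) (hi : Integrable (charFun (P.map Z))) :
    fourierTr (density Z P) = charFun (P.map Z) := by
  have := Measure.isProbabilityMeasure_map (μ := P) hZ
  ext u
  rw [charFun_apply_real,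
    ← integral_rnDeriv_smul (absolutelyContinuous_of_integrable_charFun hi), fourierTr]
  refine integral_congr_ae (ae_of_all _ fun x => ?_)
  simp only [density, pdf_def, Complex.real_smul]
  rw [mul_comm]
  congr 2
  ring

end Density

/-! ### The characteristic function of `Z_Δ`: decay and comparison with that of `X_Δ`. -/

section SmallJumpIncrement

variable {Ω : Type*} [MeasurableSpace Ω] {P : Measure Ω} {S : ℝ≥0 → Ω → ℝ} {ν : Measure ℝ}
  {ε Δ : ℝ}

theorem IsSmallJumpProcess.aemeasurable_smallJumpIncrement (hS : IsSmallJumpProcess S P ν ε) :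
    AEMeasurable (smallJumpIncrement S ν ε Δ) P :=
  (hS.isLevyProcess.aemeasurable _).const_add _

theorem IsSmallJumpProcess.charFun_smallJumpIncrement (hS : IsSmallJumpProcess S P ν ε)
    (hΔ : 0 < Δ) (u : ℝ) :
    charFun (P.map (smallJumpIncrement S ν ε Δ)) u =
      Complex.exp (Δ * (Complex.I * u * smallDrift ν ε + smallJumpExponent ν ε u)) := by
  have hm := hS.isLevyProcess.aemeasurable Δ.toNNReal
  have h := hS.charFun_eq Δ.toNNReal u
  rw [charFun_apply_real, integral_map hm (by fun_prop),
    Real.coe_toNNReal _ hΔ.le] at h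
  rw [charFun_apply_real, integral_map hS.aemeasurable_smallJumpIncrement (by fun_prop), mul_add,
    Complex.exp_add, ← h, ← integral_const_mul]
  congr 1 with ω
  rw [← Complex.exp_add, smallJumpIncrement]
  congr 1
  push_cast
  ring

theorem IsSmallJumpProcess.norm_charFun_smallJumpIncrement (hS : IsSmallJumpProcess S P ν ε)
    (hΔ : 0 < Δ) (u : ℝ) :
    ‖charFun (P.map (smallJumpIncrement S ν ε Δ)) u‖ =
      Real.exp (Δ * (smallJumpExponent ν ε u).re) := by
  rw [hS.charFun_smallJumpIncrement hΔ, Complex.norm_exp, Complex.re_ofReal_mul]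
  simp

theorem IsSmallJumpProcess.norm_charFun_le_exp (hS : IsSmallJumpProcess S P ν ε) (hΔ : 0 < Δ)
    {p : ℝ → ℝ} {M α : ℝ} (hO : OreyCondition p M α ε) (hν : IsLevyMeasure ν)
    (hp : IsLevyDensity ν p) (hε : 0 < ε) (hε1 : ε ≤ 1) {u : ℝ}
    (hu : Real.pi / (2 * ε) ≤ |u|) :
    ‖charFun (P.map (smallJumpIncrement S ν ε Δ)) u‖ ≤
      Real.exp (-(2 ^ α * M / Real.pi ^ α * Δ) * |u| ^ α) := by
  rw [hS.norm_charFun_smallJumpIncrement hΔ, hν.re_smallJumpExponent hε1]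
  refine Real.exp_le_exp.2 ?_
  have := mul_le_mul_of_nonneg_left (hO.le_integral_one_sub_cos hν hp hε hε1 hu) hΔ.le
  linarith

/-- The characteristic functions of the increment of `X` and of its small jump part differ by at
most the contribution of the compound Poisson part. -/
theorem IsSmallJumpProcess.norm_exp_levyExponent_sub_le (hS : IsSmallJumpProcess S P ν ε)
    (hΔ : 0 < Δ) (hν : IsLevyMeasure ν) (hac : ν ≪ volume) (hε : 0 < ε) (hε1 : ε ≤ 1) (u : ℝ) :
    ‖Complex.exp (Δ * levyExponent ν u) - charFun (P.map (smallJumpIncrement S ν ε Δ)) u‖ ≤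
      2 * bigJumpIntensity ν ε * Δ * ‖charFun (P.map (smallJumpIncrement S ν ε Δ)) u‖ := by
  -- In law `X_Δ` is `Z_Δ` plus an independent compound Poisson variable. The exponent of the latter
  -- has nonpositive real part, so its exponential is within `2λΔ` of `1`.
  have hfac : Complex.exp (Δ * levyExponent ν u) -
      charFun (P.map (smallJumpIncrement S ν ε Δ)) u =
      (Complex.exp (Δ * bigJumpExponent ν ε u) - 1) *
        charFun (P.map (smallJumpIncrement S ν ε Δ)) u := by
    rw [hν.levyExponent_eq hac hε hε1, mul_add (Δ : ℂ), Complex.exp_add,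
      hS.charFun_smallJumpIncrement hΔ]
    ring
  rw [hfac, norm_mul]
  gcongr
  refine (norm_exp_sub_one_le_of_re_nonpos ?_).trans ?_
  · rw [Complex.re_ofReal_mul]
    exact mul_nonpos_of_nonneg_of_nonpos hΔ.le (hν.re_bigJumpExponent hε hε1 u)
  · rw [norm_mul, Complex.norm_real, Real.norm_of_nonneg hΔ.le]
    nlinarith [hν.norm_bigJumpExponent_le hε hε1 u]

end SmallJumpIncrement

/-! ### The risk of the naive estimator. -/

section Risk

variable {Ω : Type*}

theorem norm_empiricalCharFun_le (X : ℝ≥0 → Ω → ℝ) (Δ : ℝ) (n : ℕ) (ω : Ω) (u : ℝ) :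
    ‖empiricalCharFun X Δ n ω u‖ ≤ 1 := by
  rw [empiricalCharFun, norm_mul]
  have h : ‖∑ j ∈ Finset.range n, Complex.exp (Complex.I * u * increment X Δ j ω)‖ ≤ n := by
    refine (norm_sum_le _ _).trans_eq ?_
    simp_rw [norm_exp_I_mul]
    simp
  calc _ ≤ ‖(1 / (n : ℂ))‖ * n := by gcongr
    _ ≤ 1 := by
      rw [norm_div, norm_one, Complex.norm_natCast, one_div_mul_eq_div]
      exact div_self_le_one _

theorem measurable_empiricalCharFun (X : ℝ≥0 → Ω → ℝ) (Δ : ℝ) (n : ℕ) (ω : Ω) :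
    Measurable (empiricalCharFun X Δ n ω) := by
  unfold empiricalCharFun
  fun_prop

variable [MeasurableSpace Ω] {P : Measure Ω} [IsProbabilityMeasure P]
  {X : ℝ≥0 → Ω → ℝ} {ν : Measure ℝ} {Δ : ℝ}

theorem IsPureJumpLevyProcess.lintegral_empiricalCharFun_sub_le
    (hX : IsPureJumpLevyProcess X P ν) (hΔ : 0 < Δ) {φ : ℝ → ℂ} (hφ : Measurable φ)
    (hφX : ∀ u, Complex.exp (Δ * levyExponent ν u) = φ u) {n : ℕ} (hn : 1 ≤ n) (m : ℝ) :
    ∫⁻ ω, (∫⁻ u in Ioc (-m) m, ‖empiricalCharFun X Δ n ω u - φ u‖ₑ ^ 2) ∂P ≤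
      ENNReal.ofReal (2 * m / n) := by
  have hY := hX.isLevyProcess.aemeasurable_increment Δ
  rw [lintegral_lintegral_swap]
  · calc _ ≤ ∫⁻ u in Ioc (-m) m, ENNReal.ofReal (1 / n) := by
          refine lintegral_mono fun u => ?_
          refine lintegral_enorm_empirical_sub_sq_le hY
            (hX.isLevyProcess.iIndepFun_increment Δ) (fun j => ?_) hn
          rw [hX.isLevyProcess.map_increment, hX.charFun_eq, ← hφX,
            Real.coe_toNNReal _ hΔ.le]
      _ = ENNReal.ofReal (2 * m / n) := by
          rw [setLIntegral_const, Real.volume_Ioc, ← ENNReal.ofReal_mul (by positivity)]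
          congr 1
          ring
  · have h1 : ∀ j, AEMeasurable (fun z : Ω × ℝ => increment X Δ j z.1)
        (P.prod (volume.restrict (Ioc (-m) m))) := fun j => (hY j).comp_fst
    have h2 : AEMeasurable (fun z : Ω × ℝ => ∑ j ∈ Finset.range n,
        Complex.exp (Complex.I * z.2 * increment X Δ j z.1))
        (P.prod (volume.restrict (Ioc (-m) m))) :=
      Finset.aemeasurable_fun_sum _ fun j _ => by
        have := h1 j
        fun_prop
    have h3 : AEMeasurable (fun z : Ω × ℝ => φ z.2) (P.prod (volume.restrict (Ioc (-m) m))) :=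
      (hφ.comp measurable_snd).aemeasurable
    exact (((h2.const_mul _).sub h3).enorm).pow_const 2

/-- In the application `φ` and `ψ` are the characteristic functions of `X_Δ` and `Z_Δ`, `R = 2λΔ` is
the relative error between them and `D` bounds the squared norm of `ψ`. The error is split at the
cutoff of `ψ`, then, on the Fourier side, at `φ`. -/
theorem IsPureJumpLevyProcess.lintegral_sqDist_naiveEstimator_le
    (hX : IsPureJumpLevyProcess X P ν) (hΔ : 0 < Δ) {φ ψ g : ℝ → ℂ} (hφ : Measurable φ)
    (hφX : ∀ u, Complex.exp (Δ * levyExponent ν u) = φ u) (hψ : Measurable ψ)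
    (hψ1 : ∀ u, ‖ψ u‖ ≤ 1) (hg : AEMeasurable g)
    {R D : ℝ} (hφψ : ∀ u, ‖φ u - ψ u‖ ≤ R * ‖ψ u‖)
    (hD : 0 ≤ D) (hψD : ∫⁻ u, ‖ψ u‖ₑ ^ 2 ≤ ENNReal.ofReal D) {n : ℕ} (hn : 1 ≤ n) {m : ℝ}
    (hm : 0 ≤ m) :
    ∫⁻ ω, sqDist (naiveEstimator X Δ n m ω) g ∂P ≤
      2 * sqDist (spectralCutoff m ψ) g + ENNReal.ofReal (2 * (m / n) + R ^ 2 * D) := by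
  have hi := integrable_indicator_of_bdd hψ hψ1 m
  have hpi := Real.pi_gt_three
  have hB : ∫⁻ u in Ioc (-m) m, ‖φ u - ψ u‖ₑ ^ 2 ≤ ENNReal.ofReal (R ^ 2 * D) := by
    calc _ ≤ ∫⁻ u, ‖φ u - ψ u‖ₑ ^ 2 := setLIntegral_le_lintegral _ _
      _ ≤ ∫⁻ u, ENNReal.ofReal (R ^ 2) * ‖ψ u‖ₑ ^ 2 := by
          refine lintegral_mono fun u => ?_
          simp_rw [← ofReal_norm, ← ENNReal.ofReal_pow (norm_nonneg _)]
          rw [← ENNReal.ofReal_mul (by positivity), ← mul_pow]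
          exact ENNReal.ofReal_le_ofReal (pow_le_pow_left₀ (norm_nonneg _) (hφψ u) 2)
      _ ≤ _ := by
          rw [lintegral_const_mul' _ _ ENNReal.ofReal_ne_top, ENNReal.ofReal_mul (by positivity)]
          gcongr
  set c := ENNReal.ofReal (1 / (2 * Real.pi))
  set A : Ω → ℝ≥0∞ := fun ω => ∫⁻ u in Ioc (-m) m, ‖empiricalCharFun X Δ n ω u - φ u‖ₑ ^ 2
  have hpt : ∀ ω, sqDist (naiveEstimator X Δ n m ω) g ≤
      2 * (c * 2) * A ω + (2 * (c * (2 * ENNReal.ofReal (R ^ 2 * D))) +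
        2 * sqDist (spectralCutoff m ψ) g) := fun ω => by
    have h1 : sqDist (naiveEstimator X Δ n m ω) g ≤
        2 * sqDist (naiveEstimator X Δ n m ω) (spectralCutoff m ψ) +
          2 * sqDist (spectralCutoff m ψ) g := by
      refine sqDist_le ?_
      have : Measurable (spectralCutoff m ψ) := by
        rw [spectralCutoff_eq_invFourier hm]
        exact (continuous_invFourier hi).measurable
      fun_prop
    have h2 : ∫⁻ u in Ioc (-m) m, ‖empiricalCharFun X Δ n ω u - ψ u‖ₑ ^ 2 ≤
        2 * A ω + 2 * ENNReal.ofReal (R ^ 2 * D) := by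
      calc _ ≤ ∫⁻ u in Ioc (-m) m, (2 * ‖empiricalCharFun X Δ n ω u - φ u‖ₑ ^ 2 +
            2 * ‖φ u - ψ u‖ₑ ^ 2) := lintegral_mono fun u => enorm_sub_sq_le _ _ _
        _ = 2 * A ω + 2 * ∫⁻ u in Ioc (-m) m, ‖φ u - ψ u‖ₑ ^ 2 := by
            rw [lintegral_add_right _ (by fun_prop),
              lintegral_const_mul' _ _ ENNReal.ofNat_ne_top,
              lintegral_const_mul' _ _ ENNReal.ofNat_ne_top]
        _ ≤ _ := by gcongr
    rw [naiveEstimator, sqDist_spectralCutoff_sub (measurable_empiricalCharFun X Δ n ω) hψ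
      (norm_empiricalCharFun_le X Δ n ω) hψ1 hm] at h1
    refine h1.trans ?_
    calc _ ≤ 2 * (c * (2 * A ω + 2 * ENNReal.ofReal (R ^ 2 * D))) +
          2 * sqDist (spectralCutoff m ψ) g := by gcongr
      _ = _ := by ring
  calc ∫⁻ ω, sqDist (naiveEstimator X Δ n m ω) g ∂P
      ≤ ∫⁻ ω, (2 * (c * 2) * A ω + (2 * (c * (2 * ENNReal.ofReal (R ^ 2 * D))) +
        2 * sqDist (spectralCutoff m ψ) g)) ∂P := lintegral_mono hpt
    _ = 2 * (c * 2) * (∫⁻ ω, A ω ∂P) + (2 * (c * (2 * ENNReal.ofReal (R ^ 2 * D))) +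
        2 * sqDist (spectralCutoff m ψ) g) := by
        rw [lintegral_add_right _ measurable_const, lintegral_const_mul' _ _ (by finiteness),
          lintegral_const, measure_univ, mul_one]
    _ ≤ 2 * (c * 2) * ENNReal.ofReal (2 * m / n) + (2 * (c * (2 * ENNReal.ofReal (R ^ 2 * D))) +
        2 * sqDist (spectralCutoff m ψ) g) := by
        gcongr
        exact hX.lintegral_empiricalCharFun_sub_le hΔ hφ hφX hn m
    _ = 2 * sqDist (spectralCutoff m ψ) g +
        (4 * c) * ENNReal.ofReal (2 * m / n + R ^ 2 * D) := by
        rw [ENNReal.ofReal_add (by positivity) (by positivity)]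
        ring
    _ ≤ _ := by
        gcongr
        -- The two quadratic splittings cost a factor `4`, absorbed by the Plancherel constant since
        -- `4 ≤ 2π`.
        have : (4 : ℝ≥0∞) * c ≤ 1 := by
          rw [← ENNReal.ofReal_ofNat, ← ENNReal.ofReal_mul (by norm_num)]
          refine ENNReal.ofReal_le_one.2 ?_
          rw [mul_one_div, div_le_one (by positivity)]
          linarith
        calc _ ≤ 1 * ENNReal.ofReal (2 * m / n + R ^ 2 * D) := by gcongr
          _ = _ := by rw [one_mul, mul_div_assoc]

end Risk

end SmallJumps

/-! ### Assembly and explicit constants. -/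

theorem theorem2 (α M : ℝ) (hα0 : 0 < α) (hα2 : α < 2) (hM : 0 < M) :
    ∃ K : ℝ, 0 < K ∧ ∃ κ : ℝ, 0 < κ ∧
      ∀ (ν : Measure ℝ) (p : ℝ → ℝ) (Δ ε : ℝ),
        SmallJumps.IsLevyMeasure ν → SmallJumps.IsLevyDensity ν p →
        0 < Δ → Δ < 1 → 0 < ε → ε ≤ 1 →
        SmallJumps.OreyCondition p M α ε →
        SmallJumps.bigJumpIntensity ν ε * Δ ≤ 1 →
      ∀ {Ω : Type*} [MeasurableSpace Ω] (P : Measure Ω) [IsProbabilityMeasure P]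
        (X : ℝ≥0 → Ω → ℝ), SmallJumps.IsPureJumpLevyProcess X P ν →
      ∀ {Ω' : Type*} [MeasurableSpace Ω'] (P' : Measure Ω') [IsProbabilityMeasure P']
        (S : ℝ≥0 → Ω' → ℝ), SmallJumps.IsSmallJumpProcess S P' ν ε →
      ∀ g : ℝ → ℂ, g = SmallJumps.density (SmallJumps.smallJumpIncrement S ν ε Δ) P' →
        -- `g` is a genuine density of `Z_Δ`, and it lies in `L²`
        HasPDF (SmallJumps.smallJumpIncrement S ν ε Δ) P' volume ∧ MemLp g 2 volume ∧
        -- the risk bound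
        (∀ (n : ℕ) (m : ℝ), 1 ≤ n → 1 ≤ m →
          ∫⁻ ω, SmallJumps.sqDist (SmallJumps.naiveEstimator X Δ n m ω) g ∂P ≤
            ENNReal.ofReal K *
              (SmallJumps.sqDist (SmallJumps.spectralCutoff m (SmallJumps.fourierTr g)) g +
                ENNReal.ofReal (m / n +
                  SmallJumps.bigJumpIntensity ν ε ^ 2 * Δ ^ (2 - 1 / α) *
                    Real.exp (-κ * (Δ / ε ^ α)) +
                  SmallJumps.bigJumpIntensity ν ε ^ 2 * Δ ^ 2 * ε⁻¹))) ∧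
        -- the bias bound, with its explicit constants
        (∀ m : ℝ, Real.pi / (2 * ε) ≤ m →
          SmallJumps.sqDist (SmallJumps.spectralCutoff m (SmallJumps.fourierTr g)) g ≤
            ENNReal.ofReal (1 / (2 * α * (2 * M) ^ (1 / α)) * Δ ^ (-(1 / α)) *
              SmallJumps.upperGamma (1 / α)
                (2 ^ (α + 1) * M / Real.pi ^ α * Δ * m ^ α))) := by
  have hpi := Real.pi_pos
  set B := 2 ^ α * M / Real.pi ^ α with hB
  have hB0 : 0 < B := by positivity
  set Q := 2 * (B ^ (-(1 / α)) * Real.Gamma (1 / α + 1)) with hQ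
  have hQ0 : 0 ≤ Q := by
    have := Real.Gamma_nonneg_of_nonneg (show 0 ≤ 1 / α + 1 by positivity)
    positivity
  -- The three summands of `K` are the coefficients of `m/n`, of the `ε⁻¹` term and of the
  -- exponential term; the last two come from `(2λΔ)² (π ε⁻¹ + Q Δ^(-1/α) E)`. The choice `κ = M`
  -- reflects `B (π/(2ε))^α = M ε^(-α)`.
  refine ⟨2 + 4 * Real.pi + 4 * Q, by positivity, M, hM, ?_⟩
  intro ν p Δ ε hν hp hΔ hΔ1 hε hε1 hO hlam Ω _ P _ X hX Ω' _ P' _ S hS g hg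
  subst hg
  set Z := SmallJumps.smallJumpIncrement S ν ε Δ with hZdef
  have hZ : AEMeasurable Z P' := hS.aemeasurable_smallJumpIncrement
  have := Measure.isProbabilityMeasure_map (μ := P') hZ
  set φ := charFun (P'.map Z) with hφdef
  have hφc : Continuous φ := continuous_charFun
  have hφ1 : ∀ u, ‖φ u‖ ≤ 1 := norm_charFun_le_one
  have hac : ν ≪ volume := by
    rw [hp.eq_withDensity]; exact withDensity_absolutelyContinuous _ _
  have hBΔ : 0 < B * Δ := by positivity
  have hdec : ∀ u, Real.pi / (2 * ε) ≤ |u| → ‖φ u‖ ≤ Real.exp (-(B * Δ) * |u| ^ α) :=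
    fun u hu => hS.norm_charFun_le_exp hΔ hO hν hp hε hε1 hu
  have hi : Integrable φ := SmallJumps.integrable_of_norm_le_exp hφc hφ1 hα0 hBΔ hdec
  have hL2 : MemLp φ 2 := SmallJumps.memLp_two_of_norm_le_one hi hφ1
  have hgae := SmallJumps.density_ae_eq hZ hi
  have hgL2 : MemLp (SmallJumps.density Z P') 2 :=
    (memLp_congr_ae hgae).2 (SmallJumps.memLp_two_invFourier hi hL2)
  rw [SmallJumps.fourierTr_density hZ hi]
  refine ⟨SmallJumps.hasPDF_of_integrable_charFun hZ hi, hgL2, fun n m hn hm => ?_, fun m hm => ?_⟩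
  -- Measurability in `u` is read off from the continuity of a characteristic function rather than
  -- from the integral defining the exponent.
  · have hX' : Measurable fun u => Complex.exp (Δ * SmallJumps.levyExponent ν u) := by
      have hXm := hX.isLevyProcess.aemeasurable Δ.toNNReal
      have := Measure.isProbabilityMeasure_map (μ := P) hXm
      have heq : (fun u => Complex.exp (Δ * SmallJumps.levyExponent ν u)) =
          charFun (P.map (X Δ.toNNReal)) := by
        ext u
        rw [hX.charFun_eq, Real.coe_toNNReal _ hΔ.le]
      rw [heq]
      exact continuous_charFun.measurable
    have hl0 : 0 ≤ SmallJumps.bigJumpIntensity ν ε := ENNReal.toReal_nonneg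
    set l := SmallJumps.bigJumpIntensity ν ε
    have hψD := SmallJumps.lintegral_sq_le hφ1 hα0 hBΔ (by positivity) hdec
    set E := Real.exp (-M * (Δ / ε ^ α))
    have hDeq : 2 * (Real.pi / (2 * ε)) + Real.exp (-(B * Δ) * (Real.pi / (2 * ε)) ^ α) *
        (2 * ((B * Δ) ^ (-(1 / α)) * Real.Gamma (1 / α + 1))) =
        Real.pi * ε⁻¹ + Q * (Δ ^ (-(1 / α)) * E) := by
      have h1 : -(B * Δ) * (Real.pi / (2 * ε)) ^ α = -M * (Δ / ε ^ α) := by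
        rw [hB, Real.div_rpow hpi.le (by positivity), Real.mul_rpow (by norm_num) hε.le]
        field_simp
      rw [h1, Real.mul_rpow hB0.le hΔ.le, hQ]
      change _ + E * _ = _
      field_simp
    rw [hDeq] at hψD
    have hrisk := hX.lintegral_sqDist_naiveEstimator_le hΔ hX' (fun u => rfl) hφc.measurable hφ1
      hgL2.aestronglyMeasurable.aemeasurable (R := 2 * l * Δ)
      (hS.norm_exp_levyExponent_sub_le hΔ hν hac hε hε1) (by positivity) hψD hn
      (zero_le_one.trans hm)
    refine hrisk.trans ?_
    rw [mul_add (ENNReal.ofReal _)]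
    refine add_le_add (mul_le_mul_left ?_ _) ?_
    · rw [← ENNReal.ofReal_ofNat]
      exact ENNReal.ofReal_le_ofReal (by linarith)
    · rw [← ENNReal.ofReal_mul (by positivity)]
      refine ENNReal.ofReal_le_ofReal ?_
      have hΔα : Δ ^ (2 - 1 / α) = Δ ^ 2 * Δ ^ (-(1 / α)) := by
        rw [sub_eq_add_neg, Real.rpow_add hΔ, Real.rpow_two]
      rw [hΔα]
      have hE : 0 ≤ E := (Real.exp_pos _).le
      have ha : 0 ≤ m / n := by positivity
      have hb : 0 ≤ l ^ 2 * (Δ ^ 2 * Δ ^ (-(1 / α))) * E := by positivity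
      have hc : 0 ≤ l ^ 2 * Δ ^ 2 * ε⁻¹ := by positivity
      calc 2 * (m / n) + (2 * l * Δ) ^ 2 * (Real.pi * ε⁻¹ + Q * (Δ ^ (-(1 / α)) * E))
          = 2 * (m / n) + 4 * Q * (l ^ 2 * (Δ ^ 2 * Δ ^ (-(1 / α))) * E) +
            4 * Real.pi * (l ^ 2 * Δ ^ 2 * ε⁻¹) := by ring
        _ ≤ (2 + 4 * Real.pi + 4 * Q) * (m / n) +
            (2 + 4 * Real.pi + 4 * Q) * (l ^ 2 * (Δ ^ 2 * Δ ^ (-(1 / α))) * E) +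
            (2 + 4 * Real.pi + 4 * Q) * (l ^ 2 * Δ ^ 2 * ε⁻¹) := by
            gcongr <;> linarith
        _ = _ := by ring
  · have hm0 : 0 < m := lt_of_lt_of_le (by positivity) hm
    rw [SmallJumps.sqDist_congr_right hgae,
      SmallJumps.sqDist_spectralCutoff_self hφc.measurable hi hφ1 hm0.le]
    refine (mul_le_mul_right (SmallJumps.lintegral_sq_tail_le hα0 hBΔ hm0 hm hdec) _).trans_eq ?_
    rw [← ENNReal.ofReal_mul (by positivity)]
    have h2B : 2 * (B * Δ) = 2 ^ (α + 1) * M / Real.pi ^ α * Δ := by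
      rw [hB, Real.rpow_add (by norm_num), Real.rpow_one]
      ring
    -- Since `2B = (2/π)^α · 2M`, the power `-1/α` releases a factor `π/2`, whose `π` cancels the
    -- one in the Plancherel constant `1/(2π)`.
    have hpow : (2 * (B * Δ)) ^ (-(1 / α)) =
        Real.pi / (2 * (2 * M) ^ (1 / α)) * Δ ^ (-(1 / α)) := by
      have h3 : 2 * (B * Δ) = (2 / Real.pi) ^ α * (2 * M) * Δ := by
        rw [hB, Real.div_rpow (by norm_num) hpi.le]
        ring
      rw [h3, Real.mul_rpow (by positivity) hΔ.le, Real.mul_rpow (by positivity) (by positivity),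
        ← Real.rpow_mul (by positivity), mul_neg, mul_one_div_cancel hα0.ne', Real.rpow_neg_one,
        Real.rpow_neg (by positivity)]
      field_simp
    rw [hpow, ← h2B]
    congr 1
    field_simp
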